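/- **Rao–Kupper model.** Fix $\theta>1$ and an integer $T\ge 1$. Set $$f(1;y)=\frac{e^y}{e^y+\theta},\qquad f(0;y)=\frac{(\theta^2-1)e^y}{(e^y+\theta)(\theta e^y+1)},\qquad f(-1;y)=\frac{1}{\theta e^y+1}.$$ For each $n$ let $p_n\in[0,1]$ and let $\mathbf u=\mathbf u^{(n)}\in\mathbb R^n$ be a score vector with $u_1=0$; write $M_n=\max_{i,j}|u_i-u_j|$. For every pair $1\le i<j\le n$ one observes $n_{ij}\sim \mathrm{Bin}(T,p_n)$ comparisons, with outcomes $X_{ij}^{(t)}\in\{-1,0,1\}$, $1\le t\le n_{ij}$, of mass function $f(\cdot\,;u_i-u_j)$; all the numbers $n_{ij}$ and all the outcomes are independent. The log-likelihood is $l(\mathbf v)=\sum_{i<j}\sum_{t\le n_{ij}}\log f(X_{ij}^{(t)};v_i-v_j)$, and a maximum likelihood estimate (MLE) $\hat{\mathbf u}$ is a maximizer of $l$ over $\{\mathbf v\in\mathbb R^n: v_1=0\}$. Assume that for some constant $c>1$ one has $p_n\ge c\,\frac{\log n}{n}$ for all large $n$, and that $$\Delta_n:=e^{2M_n}\sqrt{\frac{\log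 n}{np_n}}\;\frac{\log n}{\log (np_n)}\longrightarrow 0\qquad(n\to\infty).$$ Then the MLE is uniformly consistent: 1. there is a constant $C$ independent of $n$ such that, for all sufficiently large $n$, with probability at least $1-14n^{-2}$ the MLE $\hat{\mathbf u}$ exists, is unique, and satisfies $\|\hat{\mathbf u}-\mathbf u\|_\infty\le C\Delta_n$; 2. consequently, for any joint realization of the data for all $n$ on one probability space, almost surely the MLE exists and is unique for all but finitely many $n$, and $\|\hat{\mathbf u}-\mathbf u\|_\infty\to 0$ as $n\to\infty$. -/

import Mathlib

open Filter Topology MeasureTheory ProbabilityTheory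

/-- Outcomes of a comparison live in `SignType = {-1, 0, 1}` (loss, tie, win), which carries the
discrete σ-algebra. -/
instance instMeasurableSpaceSignType : MeasurableSpace SignType := ⊤

instance instDiscreteMeasurableSpaceSignType : DiscreteMeasurableSpace SignType := ⟨fun _ => trivial⟩

namespace RaoKupper

noncomputable section

/-- The Rao–Kupper link function `f(x; y)` with threshold `θ`: the probability that a subject whose
relative score against its opponent is `y` obtains the outcome `x`
(`1` = win, `0` = tie, `-1` = loss). -/
def link (θ : ℝ) : SignType → ℝ → ℝ
  | .pos, y => Real.exp y / (Real.exp y + θ)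
  | .zero, y => (θ ^ 2 - 1) * Real.exp y / ((Real.exp y + θ) * (θ * Real.exp y + 1))
  | .neg, y => 1 / (θ * Real.exp y + 1)

/-- The law of a single comparison: the measure on `{-1, 0, 1}` with mass function `f(·; y)`. -/
def outcomeLaw (θ y : ℝ) : Measure SignType :=
  ∑ x : SignType, ENNReal.ofReal (link θ x y) • Measure.dirac x

/-- The pairs `(i, j)` of subjects with `i < j`. -/
abbrev Pair (n : ℕ) : Type := {e : Fin n × Fin n // e.1 < e.2}

/-- The data for `n` subjects: every pair `i < j` carries the number `n_ij` of its observed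
comparisons and a list of (potential) outcomes, seen from `i`, of which only the first `n_ij` are
observed. -/
abbrev Data (n T : ℕ) : Type := Pair n → ℕ × (Fin T → SignType)

/-- The law of the data in the Rao–Kupper model with score vector `u`: all the `n_ij` and all the
outcomes are independent, `n_ij` is binomial `Bin(T, p)`, and each outcome of the pair `(i, j)`
has the mass function `f(·; u_i - u_j)`. -/
def dataLaw (θ : ℝ) (T : ℕ) (p : unitInterval) {n : ℕ} (u : Fin n → ℝ) : Measure (Data n T) :=
  Measure.pi fun e : Pair n =>
    (ProbabilityTheory.binomial T p).prod
      (Measure.pi fun _ : Fin T => outcomeLaw θ (u e.1.1 - u e.1.2))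

/-- The log-likelihood `l(v) = ∑_{i < j} ∑_{t ≤ n_ij} log f(X_ij^(t); v_i - v_j)`, a function of the
observed comparisons only. -/
def logLikelihood (θ : ℝ) {n T : ℕ} (d : Data n T) (v : Fin n → ℝ) : ℝ :=
  ∑ e : Pair n, ∑ t : Fin T with t.val < (d e).1,
    Real.log (link θ ((d e).2 t) (v e.1.1 - v e.1.2))

/-- The score vectors whose first coordinate vanishes (the identifiability constraint). -/
def normalized (n : ℕ) : Set (Fin n → ℝ) := {v | ∀ i : Fin n, i.val = 0 → v i = 0}

/-- `v` is a maximum likelihood estimate: it maximizes the log-likelihood over all score vectors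
with first coordinate `0`. -/
def IsMLE (θ : ℝ) {n T : ℕ} (d : Data n T) (v : Fin n → ℝ) : Prop :=
  v ∈ normalized n ∧ IsMaxOn (logLikelihood θ d) (normalized n) v

/-- The dynamic range `M_n = max_{i,j} |u_i - u_j|`. -/
def dynamicRange {n : ℕ} (u : Fin n → ℝ) : ℝ := ⨆ e : Fin n × Fin n, |u e.1 - u e.2|

/-- The quantity `Δ_n = e^{2 M_n} √(log n / (n p_n)) · log n / log (n p_n)`. -/
def rate {n : ℕ} (p : unitInterval) (u : Fin n → ℝ) : ℝ :=
  Real.exp (2 * dynamicRange u) * √(Real.log n / (n * (p : ℝ))) *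
    (Real.log n / Real.log (n * (p : ℝ)))

end

end RaoKupper

/-! The log-probability of one comparison is concave in `y`, and its derivative `score` drops at
rate at least a constant times `e^{-M}` near any `|y| ≤ M`. For a set `A` of subjects, the
derivative of the log-likelihood in the direction of the indicator of `A` is the net flow of
`pairScore` out of `A`. This flow vanishes at an MLE. At the true `u` it is a sum of mean-zero
terms, of size at most `s |A|` with `s` of order `√(np log n)`.

Let `δ` be the error of an MLE and let `B_k` consist of the subjects with `δ ≥ δ_i - k h`. Every
pair from `B_k` to the complement of `B_{k+1}` has a gap above `h`, so each of its observed
comparisons contributes at least `slope * h` to the flow. If `B_{k+1}` had at most half of the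
subjects and at most `r |B_k|` of them, expansion of the comparison graph would give more than `q
|B_k|` such comparisons. Taking `h` with `slope * h * q ≥ s` makes this impossible, so the level
sets grow by a factor `r`, of order `np / log n`, until they pass `n / 2`. This takes `K`, of order
`log n / log (np)`, steps. The level sets from the top and from the bottom then meet, so `δ` has
spread at most `2 K h` (`IsGain.sub_le`).

The same argument with `s = 0` and `h → 0` gives uniqueness. Existence follows because no proper set
of subjects can win all its observed outside comparisons, which makes the likelihood coercive
(`Connects.exists_isMLE`).

Expansion and small flows hold with high probability by Chernoff and union bounds
(`dataLaw_real_not_expands_le`, `dataLaw_real_flow_le`). Borel–Cantelli gives the almost sure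
statement. -/

namespace RaoKupper

noncomputable section

/-! ### The score function of a single comparison -/

/-- The derivative of the log-probability of a win. -/
def winScore (θ y : ℝ) : ℝ := θ / (Real.exp y + θ)

/-- The score function `∂_y log f(x; y)` of a single comparison. -/
def score (θ : ℝ) : SignType → ℝ → ℝ
  | .pos, y => winScore θ y
  | .zero, y => winScore θ y - winScore θ (-y)
  | .neg, y => -winScore θ (-y)

variable {θ : ℝ}

lemma winScore_pos (hθ : 1 < θ) (y : ℝ) : 0 < winScore θ y := by
  unfold winScore; positivity

lemma winScore_le_one (hθ : 1 < θ) (y : ℝ) : winScore θ y ≤ 1 := by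
  unfold winScore
  rw [div_le_one (by positivity)]
  linarith [Real.exp_pos y]

lemma winScore_antitone (hθ : 1 < θ) : Antitone (winScore θ) := by
  intro x y hxy
  unfold winScore
  gcongr

lemma winScore_neg (y : ℝ) : winScore θ (-y) = θ * Real.exp y / (θ * Real.exp y + 1) := by
  unfold winScore
  rw [Real.exp_neg]
  field_simp
  ring

lemma score_antitone (hθ : 1 < θ) (x : SignType) : Antitone (score θ x) := by
  intro y z hyz
  have h1 := winScore_antitone hθ hyz
  have h2 := winScore_antitone hθ (neg_le_neg hyz)
  cases x <;> simp only [score] <;> linarith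

lemma abs_score_le_one (hθ : 1 < θ) (x : SignType) (y : ℝ) : |score θ x y| ≤ 1 := by
  have h1 := winScore_pos hθ y
  have h2 := winScore_pos hθ (-y)
  have h3 := winScore_le_one hθ y
  have h4 := winScore_le_one hθ (-y)
  rw [abs_le]
  cases x <;> simp only [score] <;> constructor <;> linarith

lemma link_pos (hθ : 1 < θ) (x : SignType) (y : ℝ) : 0 < link θ x y := by
  have : 0 < θ ^ 2 - 1 := by nlinarith
  cases x <;> simp only [link] <;> positivity

lemma link_sum (hθ : 1 < θ) (y : ℝ) : link θ .neg y + link θ .zero y + link θ .pos y = 1 := by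
  have := Real.exp_pos y
  simp only [link]
  field_simp
  ring

lemma link_le_one (hθ : 1 < θ) (x : SignType) (y : ℝ) : link θ x y ≤ 1 := by
  have h1 := link_pos hθ .neg y
  have h2 := link_pos hθ .zero y
  have h3 := link_pos hθ .pos y
  have := link_sum hθ y
  cases x
  · exact (by linarith : link θ .zero y ≤ 1)
  · exact (by linarith : link θ .neg y ≤ 1)
  · exact (by linarith : link θ .pos y ≤ 1)

/-- The score has mean zero under the true parameter. -/
lemma link_mul_score_sum (hθ : 1 < θ) (y : ℝ) :
    link θ .neg y * score θ .neg y + link θ .zero y * score θ .zero y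
      + link θ .pos y * score θ .pos y = 0 := by
  have := Real.exp_pos y
  simp only [link, score, winScore_neg]
  unfold winScore
  field_simp
  ring

lemma hasDerivAt_log_link (hθ : 1 < θ) (x : SignType) (y : ℝ) :
    HasDerivAt (fun z => Real.log (link θ x z)) (score θ x y) y := by
  have hE : HasDerivAt Real.exp (Real.exp y) y := Real.hasDerivAt_exp y
  have h0 := Real.exp_pos y
  have hc : 0 < θ ^ 2 - 1 := by nlinarith
  have h1 : HasDerivAt (fun z => Real.exp z + θ) (Real.exp y) y := hE.add_const θ
  have h2 : HasDerivAt (fun z => θ * Real.exp z + 1) (θ * Real.exp y) y :=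
    (hE.const_mul θ).add_const 1
  have p1 : 0 < Real.exp y + θ := by positivity
  have p2 : 0 < θ * Real.exp y + 1 := by positivity
  cases x
  · have := (((hE.const_mul (θ ^ 2 - 1)).fun_div (h1.fun_mul h2) (by positivity))).log
      (by have := link_pos hθ .zero y; exact this.ne')
    refine this.congr_deriv ?_
    simp only [score, winScore_neg]
    unfold winScore
    field_simp
    ring
  · have := ((hasDerivAt_const y (1 : ℝ)).fun_div h2 (by positivity)).log
      (by have := link_pos hθ .neg y; exact this.ne')
    refine this.congr_deriv ?_
    simp only [score, winScore_neg]
    field_simp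
    ring
  · have := (hE.fun_div h1 (by positivity)).log
      (by have := link_pos hθ .pos y; exact this.ne')
    refine this.congr_deriv ?_
    simp only [score, winScore]
    field_simp
    ring

/-! ### Quantitative strict concavity of a single comparison -/

/-- A lower bound for the slope of the score function at scores of size at most `M`. -/
def slope (θ M : ℝ) : ℝ := θ * Real.exp (-M) / (3 * (1 + θ) ^ 2)

lemma slope_pos (hθ : 1 < θ) (M : ℝ) : 0 < slope θ M := by unfold slope; positivity

lemma slope_le_exp_mul (hθ : 1 < θ) {M y : ℝ} (hy : |y| ≤ M) :
    slope θ M ≤ θ * Real.exp y / (3 * (Real.exp y + θ) ^ 2) := by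
  obtain ⟨h1, h2⟩ := abs_le.1 hy
  have hM := Real.exp_pos M
  have a1 : Real.exp y ≤ Real.exp M := Real.exp_le_exp.2 h2
  have a2 : 1 ≤ Real.exp y * Real.exp M := by
    rw [← Real.exp_add]; exact Real.one_le_exp (by linarith)
  have a3 : 1 ≤ Real.exp M := Real.one_le_exp (by linarith)
  have h0 := Real.exp_pos y
  unfold slope
  rw [Real.exp_neg, div_le_div_iff₀ (by positivity) (by positivity)]
  -- Expand the square and bound its terms using `e^y ≤ e^M` and `1 ≤ e^y e^M`.
  have key : (Real.exp y + θ) ^ 2 ≤ Real.exp y * Real.exp M * (1 + θ) ^ 2 := by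
    have b1 : Real.exp y * Real.exp y ≤ Real.exp y * Real.exp M := by gcongr
    have b2 : Real.exp y * θ ≤ Real.exp y * Real.exp M * θ := by
      gcongr; nlinarith
    have b3 : θ ^ 2 ≤ Real.exp y * Real.exp M * θ ^ 2 := by
      nlinarith [sq_nonneg θ]
    nlinarith
  calc θ * (Real.exp M)⁻¹ * (3 * (Real.exp y + θ) ^ 2)
      ≤ θ * (Real.exp M)⁻¹ * (3 * (Real.exp y * Real.exp M * (1 + θ) ^ 2)) := by gcongr
    _ = _ := by field_simp

lemma slope_mul_le_sub (hθ : 1 < θ) {M y h : ℝ} (hy : |y| ≤ M) (h0 : 0 ≤ h) (h1 : h ≤ 1) :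
    slope θ M * h ≤ winScore θ y - winScore θ (y + h) := by
  have e0 := Real.exp_pos y
  have e1 : 1 + h ≤ Real.exp h := by linarith [Real.add_one_le_exp h]
  -- This is the source of the factor 3 in `slope`: moving by `h ≤ 1` enlarges the denominator at
  -- most threefold.
  have e2 : Real.exp h ≤ 3 := by
    have := Real.exp_le_exp.2 h1
    linarith [Real.exp_one_lt_d9]
  have : winScore θ y - winScore θ (y + h) =
      θ * Real.exp y * (Real.exp h - 1) / ((Real.exp y + θ) * (Real.exp y * Real.exp h + θ)) := by
    unfold winScore
    rw [Real.exp_add]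
    have := Real.exp_pos h
    field_simp
    ring
  rw [this]
  calc slope θ M * h ≤ θ * Real.exp y / (3 * (Real.exp y + θ) ^ 2) * h := by
        gcongr; exact slope_le_exp_mul hθ hy
    _ = θ * Real.exp y * h / ((Real.exp y + θ) * (3 * (Real.exp y + θ))) := by field_simp
    _ ≤ _ := by
        have : 0 ≤ Real.exp h - 1 := by linarith
        gcongr
        · linarith
        · nlinarith

lemma slope_mul_le_sub' (hθ : 1 < θ) {M y h : ℝ} (hy : |y| ≤ M) (h0 : 0 ≤ h) (h1 : h ≤ 1) :
    slope θ M * h ≤ winScore θ (y - h) - winScore θ y := by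
  have e0 := Real.exp_pos y
  have e1 : 1 + h ≤ Real.exp h := by linarith [Real.add_one_le_exp h]
  have e2 : Real.exp h ≤ 3 := by
    have := Real.exp_le_exp.2 h1
    linarith [Real.exp_one_lt_d9]
  have : winScore θ (y - h) - winScore θ y =
      θ * Real.exp y * (Real.exp h - 1) / ((Real.exp y + θ) * (Real.exp y + θ * Real.exp h)) := by
    unfold winScore
    rw [Real.exp_sub]
    have := Real.exp_pos h
    field_simp
    ring
  rw [this]
  calc slope θ M * h ≤ θ * Real.exp y / (3 * (Real.exp y + θ) ^ 2) * h := by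
        gcongr; exact slope_le_exp_mul hθ hy
    _ = θ * Real.exp y * h / ((Real.exp y + θ) * (3 * (Real.exp y + θ))) := by field_simp
    _ ≤ _ := by
        have : 0 ≤ Real.exp h - 1 := by linarith
        gcongr
        · linarith
        · nlinarith

/-- Only the base point `y` is bounded, and the displacement `t` is arbitrary: monotonicity
truncates it to `h ≤ 1`. No a priori bound on the MLE is therefore needed later. -/
lemma slope_mul_le_score_sub (hθ : 1 < θ) (x : SignType) {M y h t : ℝ} (hy : |y| ≤ M)
    (h0 : 0 ≤ h) (h1 : h ≤ 1) (ht : h ≤ t) :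
    slope θ M * h ≤ score θ x y - score θ x (y + t) := by
  have hn : |-y| ≤ M := by rwa [abs_neg]
  have a1 := slope_mul_le_sub hθ hy h0 h1
  have a2 := slope_mul_le_sub' hθ hn h0 h1
  have a3 : winScore θ (y + t) ≤ winScore θ (y + h) := winScore_antitone hθ (by linarith)
  have a4 : winScore θ (-y - h) ≤ winScore θ (-(y + t)) := winScore_antitone hθ (by linarith)
  have a5 : 0 ≤ slope θ M * h := mul_nonneg (slope_pos hθ M).le h0
  cases x <;> simp only [score] <;> linarith

lemma score_sub_le_neg_slope_mul (hθ : 1 < θ) (x : SignType) {M y h t : ℝ} (hy : |y| ≤ M)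
    (h0 : 0 ≤ h) (h1 : h ≤ 1) (ht : t ≤ -h) :
    score θ x y - score θ x (y + t) ≤ -(slope θ M * h) := by
  have hn : |-y| ≤ M := by rwa [abs_neg]
  have a1 := slope_mul_le_sub' hθ hy h0 h1
  have a2 := slope_mul_le_sub hθ hn h0 h1
  have a3 : winScore θ (y - h) ≤ winScore θ (y + t) := winScore_antitone hθ (by linarith)
  have a4 : winScore θ (-(y + t)) ≤ winScore θ (-y + h) := winScore_antitone hθ (by linarith)
  have a5 : 0 ≤ slope θ M * h := mul_nonneg (slope_pos hθ M).le h0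
  cases x <;> simp only [score] <;> linarith

/-- The win score itself exceeds the slope bound. -/
lemma slope_le_winScore (hθ : 1 < θ) {M y : ℝ} (hy : |y| ≤ M) : slope θ M ≤ winScore θ y := by
  have a := slope_mul_le_sub hθ hy zero_le_one le_rfl
  have b := winScore_pos hθ (y + 1)
  linarith

/-! ### Coercivity of a single comparison -/

/-- The logarithm of the probability of not winning is at most `log θ - y`. -/
lemma log_link_le_of_ne_pos (hθ : 1 < θ) {x : SignType} (hx : x ≠ 1) (y : ℝ) :
    Real.log (link θ x y) ≤ Real.log θ - y := by
  have e0 := Real.exp_pos y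
  rw [← Real.log_exp y, ← Real.log_div (by positivity) (by positivity), Real.log_exp]
  apply Real.log_le_log (link_pos hθ x y)
  cases x
  · simp only [link]
    rw [div_le_div_iff₀ (by positivity) (by positivity)]
    have : θ * (Real.exp y * (θ * Real.exp y)) ≤
        θ * ((Real.exp y + θ) * (θ * Real.exp y + 1)) := by gcongr <;> linarith
    nlinarith [mul_pos e0 e0]
  · simp only [link]
    rw [div_le_div_iff₀ (by positivity) (by positivity)]
    have : 1 * Real.exp y ≤ θ * θ * Real.exp y := by gcongr; nlinarith
    nlinarith
  · exact absurd rfl hx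

/-- The logarithm of the probability of not losing is at most `log θ + y`. -/
lemma log_link_le_of_ne_neg (hθ : 1 < θ) {x : SignType} (hx : x ≠ -1) (y : ℝ) :
    Real.log (link θ x y) ≤ Real.log θ + y := by
  have e0 := Real.exp_pos y
  rw [← Real.log_exp y, ← Real.log_mul (by positivity) (by positivity), Real.log_exp]
  apply Real.log_le_log (link_pos hθ x y)
  cases x
  · simp only [link]
    rw [div_le_iff₀ (by positivity)]
    have : 1 * θ ≤ (Real.exp y + θ) * (θ * Real.exp y + 1) := by
      nlinarith [mul_pos e0 e0, mul_pos e0 (by linarith : 0 < θ)]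
    nlinarith [mul_pos e0 (by linarith : 0 < θ)]
  · exact absurd rfl hx
  · simp only [link]
    rw [div_le_iff₀ (by positivity)]
    nlinarith [mul_pos e0 (by linarith : 0 < θ), mul_pos e0 e0]

variable {n T : ℕ}

/-! ### Flows out of sets of subjects -/

/-- The real-valued indicator of a set of subjects. -/
def ind (A : Finset (Fin n)) (i : Fin n) : ℝ := if i ∈ A then 1 else 0

/-- The net flow out of `A` of an (oriented) weight on the pairs. -/
def flow (A : Finset (Fin n)) (γ : Pair n → ℝ) : ℝ :=
  ∑ e : Pair n, γ e * (ind A e.1.1 - ind A e.1.2)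

/-- The pairs with one member in `A` and the other in `C`. -/
def cutPairs (A C : Finset (Fin n)) : Finset (Pair n) :=
  Finset.univ.filter fun e => (e.1.1 ∈ A ∧ e.1.2 ∈ C) ∨ (e.1.2 ∈ A ∧ e.1.1 ∈ C)

/-- The total weight between `A` and `C`. -/
def cut (N : Pair n → ℝ) (A C : Finset (Fin n)) : ℝ := ∑ e ∈ cutPairs A C, N e

lemma mem_cutPairs {A C : Finset (Fin n)} {e : Pair n} :
    e ∈ cutPairs A C ↔ (e.1.1 ∈ A ∧ e.1.2 ∈ C) ∨ (e.1.2 ∈ A ∧ e.1.1 ∈ C) := by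
  simp [cutPairs]

lemma cut_comm (N : Pair n → ℝ) (A C : Finset (Fin n)) : cut N A C = cut N C A := by
  unfold cut
  congr 1
  ext e
  simp only [mem_cutPairs]
  tauto

lemma ind_eq_sum (A : Finset (Fin n)) (i : Fin n) : ind A i = ∑ k ∈ A, ind {k} i := by
  simp [ind]

lemma flow_eq_sum (A : Finset (Fin n)) (γ : Pair n → ℝ) : flow A γ = ∑ k ∈ A, flow {k} γ := by
  unfold flow
  rw [Finset.sum_comm]
  refine Finset.sum_congr rfl fun e _ => ?_
  rw [ind_eq_sum A, ind_eq_sum A, ← Finset.sum_sub_distrib, Finset.mul_sum]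

lemma abs_flow_le {γ : Pair n → ℝ} {s : ℝ} (h : ∀ k, |flow {k} γ| ≤ s) (A : Finset (Fin n)) :
    |flow A γ| ≤ s * A.card := by
  rw [flow_eq_sum]
  refine (Finset.abs_sum_le_sum_abs _ _).trans ?_
  refine (Finset.sum_le_sum fun k _ => h k).trans ?_
  simp [mul_comm]

lemma flow_compl (A : Finset (Fin n)) (γ : Pair n → ℝ) : flow Aᶜ γ = -flow A γ := by
  have h (i : Fin n) : ind Aᶜ i = 1 - ind A i := by
    unfold ind
    by_cases hi : i ∈ A <;> simp [hi]
  unfold flow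
  rw [← Finset.sum_neg_distrib]
  refine Finset.sum_congr rfl fun e _ => ?_
  rw [h, h]
  ring

lemma flow_neg (A : Finset (Fin n)) (γ : Pair n → ℝ) : flow A (-γ) = -flow A γ := by
  simp [flow]

lemma flow_sub (A : Finset (Fin n)) (γ η : Pair n → ℝ) :
    flow A (γ - η) = flow A γ - flow A η := by
  simp [flow, sub_mul]

/-- Pairs inside `A` or inside its complement cancel in the flow. Pairs leaving `A` without reaching
`C` only need the right sign, so the pairs between `A` and `C` give the bound. -/
lemma mul_cut_le_flow {N γ : Pair n → ℝ} {a : ℝ} {A C : Finset (Fin n)} (hAC : Disjoint A C)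
    (h1 : ∀ e : Pair n, e.1.1 ∈ A → e.1.2 ∉ A → 0 ≤ γ e)
    (h2 : ∀ e : Pair n, e.1.2 ∈ A → e.1.1 ∉ A → γ e ≤ 0)
    (h3 : ∀ e : Pair n, e.1.1 ∈ A → e.1.2 ∈ C → a * N e ≤ γ e)
    (h4 : ∀ e : Pair n, e.1.2 ∈ A → e.1.1 ∈ C → γ e ≤ -(a * N e)) :
    a * cut N A C ≤ flow A γ := by
  have hC : ∀ i ∈ A, i ∉ C := fun i hi => Finset.disjoint_left.1 hAC hi
  have : a * cut N A C = ∑ e : Pair n, if e ∈ cutPairs A C then a * N e else 0 := by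
    unfold cut
    rw [Finset.mul_sum, Finset.sum_ite_mem, Finset.univ_inter]
  rw [this]
  unfold flow
  refine Finset.sum_le_sum fun e _ => ?_
  have m := @mem_cutPairs n A C e
  by_cases hi : e.1.1 ∈ A <;> by_cases hj : e.1.2 ∈ A
  · have : e ∉ cutPairs A C := by rw [m]; rintro (h | h); exacts [hC _ hj h.2, hC _ hi h.2]
    simp [ind, hi, hj, this]
  · by_cases hc : e.1.2 ∈ C
    · have : e ∈ cutPairs A C := m.2 (Or.inl ⟨hi, hc⟩)
      simpa [ind, hi, hj, this] using h3 e hi hc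
    · have : e ∉ cutPairs A C := by rw [m]; tauto
      simpa [ind, hi, hj, this] using h1 e hi hj
  · by_cases hc : e.1.1 ∈ C
    · have he : e ∈ cutPairs A C := m.2 (Or.inr ⟨hj, hc⟩)
      have := h4 e hj hc
      simp only [ind, hi, hj, he, if_true, if_false]
      linarith
    · have : e ∉ cutPairs A C := by rw [m]; tauto
      simpa [ind, hi, hj, this] using h2 e hj hi
  · have : e ∉ cutPairs A C := by rw [m]; tauto
    simp [ind, hi, hj, this]

/-! ### Expansion and growth of level sets -/

/-- Quantitative expansion of a weighted graph: a set `A` sends weight more than `q |A|` outside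
every moderately larger set. -/
def Expands (N : Pair n → ℝ) (r q : ℝ) : Prop :=
  ∀ A A' : Finset (Fin n), A.Nonempty → A ⊆ A' → 2 * A'.card ≤ n → (A'.card : ℝ) ≤ r * A.card →
    q * A.card < cut N A A'ᶜ

/-- A weight `γ` on the pairs that dominates the differences of `δ`. -/
structure IsGain (N γ : Pair n → ℝ) (δ : Fin n → ℝ) (a h : ℝ) : Prop where
  nonneg : ∀ e : Pair n, 0 ≤ δ e.1.1 - δ e.1.2 → 0 ≤ γ e
  nonpos : ∀ e : Pair n, δ e.1.1 - δ e.1.2 ≤ 0 → γ e ≤ 0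
  le : ∀ e : Pair n, h ≤ δ e.1.1 - δ e.1.2 → a * N e ≤ γ e
  ge : ∀ e : Pair n, δ e.1.1 - δ e.1.2 ≤ -h → γ e ≤ -(a * N e)

lemma IsGain.neg {N γ : Pair n → ℝ} {δ : Fin n → ℝ} {a h : ℝ} (H : IsGain N γ δ a h) :
    IsGain N (-γ) (-δ) a h where
  nonneg e he := by
    have := H.nonpos e (by simp only [Pi.neg_apply] at he; linarith)
    simpa using this
  nonpos e he := by
    have := H.nonneg e (by simp only [Pi.neg_apply] at he; linarith)
    simpa using this
  le e he := by
    have := H.ge e (by simp only [Pi.neg_apply] at he; linarith)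
    simp only [Pi.neg_apply]; linarith
  ge e he := by
    have := H.le e (by simp only [Pi.neg_apply] at he; linarith)
    simp only [Pi.neg_apply]; linarith

lemma lt_two_mul_card_of_growth (hn : 0 < n) {B : ℕ → Finset (Fin n)} (hmono : Monotone B)
    (h0 : (B 0).Nonempty) {r : ℝ} (hr : 1 ≤ r)
    (hstep : ∀ k, n < 2 * (B (k + 1)).card ∨ r * (B k).card < (B (k + 1)).card) {K : ℕ}
    (hK : (n : ℝ) ≤ r ^ K) : n < 2 * (B K).card := by
  have key : ∀ k, n < 2 * (B k).card ∨ r ^ k ≤ (B k).card := by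
    intro k
    induction k with
    | zero => right; simpa using h0
    | succ k ih =>
      rcases ih with ih | ih
      · left
        have : (B k).card ≤ (B (k + 1)).card := Finset.card_le_card (hmono (Nat.le_succ k))
        omega
      · rcases hstep k with h | h
        · exact Or.inl h
        · right
          calc r ^ (k + 1) = r * r ^ k := by ring
            _ ≤ r * (B k).card := by gcongr
            _ ≤ _ := h.le
  rcases key K with h | h
  · exact h
  · have : (n : ℝ) ≤ (B K).card := hK.trans h
    have : n ≤ (B K).card := by exact_mod_cast this
    omega

/-- The level sets `B k` are nested, and pairs from `B k` to the complement of `B (k + 1)` have gap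
above `h`. If `B (k + 1)` were neither a majority nor `r` times larger than `B k`, expansion would
force a flow out of `B k` above `a q |B k| ≥ s |B k|`. -/
lemma IsGain.lt_two_mul_card {N γ : Pair n → ℝ} {δ : Fin n → ℝ} {a h r q s : ℝ} {K : ℕ}
    (H : IsGain N γ δ a h) (ha : 0 < a) (hh : 0 ≤ h) (hN : Expands N r q) (hr : 1 ≤ r)
    (hs : s ≤ a * q) (hγ : ∀ A, flow A γ ≤ s * A.card) (hK : (n : ℝ) ≤ r ^ K) (i₀ : Fin n) :
    n < 2 * (Finset.univ.filter fun i => δ i₀ - K * h ≤ δ i).card := by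
  set B : ℕ → Finset (Fin n) := fun k => Finset.univ.filter fun i => δ i₀ - k * h ≤ δ i with hB
  have mem (k : ℕ) (i : Fin n) : i ∈ B k ↔ δ i₀ - k * h ≤ δ i := by simp [hB]
  have hmono : Monotone B := by
    intro k l hkl i hi
    rw [mem] at hi ⊢
    have : (k : ℝ) * h ≤ l * h := by gcongr
    linarith
  have h0 : ∀ k, i₀ ∈ B k := fun k => by
    rw [mem]
    have : 0 ≤ (k : ℝ) * h := by positivity
    linarith
  refine lt_two_mul_card_of_growth (i₀.pos) hmono ⟨i₀, h0 0⟩ hr (fun k => ?_) hK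
  by_contra! hc
  have e1 := hN (B k) (B (k + 1)) ⟨i₀, h0 k⟩ (hmono (Nat.le_succ k)) hc.1 hc.2
  have e2 : a * cut N (B k) (B (k + 1))ᶜ ≤ flow (B k) γ := by
    refine mul_cut_le_flow ?_ (fun e hi hj => H.nonneg e ?_) (fun e hj hi => H.nonpos e ?_)
      (fun e hi hj => H.le e ?_) (fun e hj hi => H.ge e ?_)
    · rw [Finset.disjoint_left]
      intro i hi
      simpa using hmono (Nat.le_succ k) hi
    all_goals
      simp only [Finset.mem_compl, mem, not_le] at hi hj
      push_cast at hi hj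
      linarith
  have e3 := hγ (B k)
  have hc0 : 0 < ((B k).card : ℝ) := by
    exact_mod_cast Finset.card_pos.2 ⟨i₀, h0 k⟩
  have : a * (q * (B k).card) < a * cut N (B k) (B (k + 1))ᶜ := by gcongr
  have : s * (B k).card ≤ a * q * (B k).card := by gcongr
  linarith

lemma IsGain.sub_le {N γ : Pair n → ℝ} {δ : Fin n → ℝ} {a h r q s : ℝ} {K : ℕ}
    (H : IsGain N γ δ a h) (ha : 0 < a) (hh : 0 ≤ h) (hN : Expands N r q) (hr : 1 ≤ r)
    (hs : s ≤ a * q) (hγ : ∀ A, |flow A γ| ≤ s * A.card) (hK : (n : ℝ) ≤ r ^ K) (i j : Fin n) :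
    δ i - δ j ≤ 2 * K * h := by
  have h1 := H.lt_two_mul_card ha hh hN hr hs (fun A => (abs_le.1 (hγ A)).2) hK i
  have h2 := H.neg.lt_two_mul_card ha hh hN hr hs
    (fun A => by rw [flow_neg]; linarith [(abs_le.1 (hγ A)).1]) hK j
  -- Two strict majorities, one close to `δ i` or above it and one close to `δ j` or below it, share
  -- a subject `k`.
  obtain ⟨k, hk⟩ : ((Finset.univ.filter fun k => δ i - K * h ≤ δ k) ∩
      (Finset.univ.filter fun k => (-δ) j - K * h ≤ (-δ) k)).Nonempty := by
    apply Finset.inter_nonempty_of_card_lt_card_add_card (Finset.subset_univ _)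
      (Finset.subset_univ _)
    rw [Finset.card_univ, Fintype.card_fin]
    omega
  simp only [Finset.mem_inter, Finset.mem_filter, Finset.mem_univ, true_and, Pi.neg_apply] at hk
  linarith

/-! ### The likelihood equations -/

/-- The number of observed comparisons of a pair. -/
def obsCount (d : Data n T) (e : Pair n) : ℝ :=
  ((Finset.univ.filter fun t : Fin T => t.val < (d e).1).card : ℝ)

/-- The total score of a pair. -/
def pairScore (θ : ℝ) (d : Data n T) (v : Fin n → ℝ) (e : Pair n) : ℝ :=
  ∑ t : Fin T with t.val < (d e).1, score θ ((d e).2 t) (v e.1.1 - v e.1.2)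

lemma hasDerivAt_logLikelihood (hθ : 1 < θ) (d : Data n T) (v : Fin n → ℝ) (A : Finset (Fin n)) :
    HasDerivAt (fun s : ℝ => logLikelihood θ d (fun i => v i + s * ind A i))
      (flow A (pairScore θ d v)) 0 := by
  unfold logLikelihood flow
  refine HasDerivAt.fun_sum fun e _ => ?_
  unfold pairScore
  rw [Finset.sum_mul]
  refine HasDerivAt.fun_sum fun t _ => ?_
  have h1 : HasDerivAt (fun s : ℝ => (v e.1.1 + s * ind A e.1.1) - (v e.1.2 + s * ind A e.1.2))
      (ind A e.1.1 - ind A e.1.2) 0 := by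
    have := (((hasDerivAt_id (0 : ℝ)).mul_const (ind A e.1.1)).const_add (v e.1.1)).fun_sub
      (((hasDerivAt_id (0 : ℝ)).mul_const (ind A e.1.2)).const_add (v e.1.2))
    simpa using this
  have h2 := hasDerivAt_log_link hθ ((d e).2 t) (v e.1.1 - v e.1.2)
  exact HasDerivAt.comp (0 : ℝ) (by simpa using h2) h1

lemma continuous_logLikelihood (hθ : 1 < θ) (d : Data n T) :
    Continuous (logLikelihood θ d) := by
  unfold logLikelihood
  refine continuous_finsetSum _ fun e _ => continuous_finsetSum _ fun t _ => ?_
  have h : Continuous fun z => Real.log (link θ ((d e).2 t) z) :=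
    continuous_iff_continuousAt.2 fun y => (hasDerivAt_log_link hθ _ y).continuousAt
  exact h.comp (by fun_prop)

lemma logLikelihood_sub_const (d : Data n T) (v : Fin n → ℝ) (c : ℝ) :
    logLikelihood θ d (fun i => v i - c) = logLikelihood θ d v := by
  simp [logLikelihood]

/-- Shift invariance removes the normalization, so perturbations by indicators of sets containing
the first subject are allowed. -/
lemma IsMLE.le (hn : 0 < n) {d : Data n T} {v : Fin n → ℝ} (hv : IsMLE θ d v) (w : Fin n → ℝ) :
    logLikelihood θ d w ≤ logLikelihood θ d v := by
  rw [← logLikelihood_sub_const d w (w ⟨0, hn⟩)]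
  refine hv.2 fun i hi => ?_
  have : i = ⟨0, hn⟩ := Fin.ext hi
  simp [this]

lemma IsMLE.flow_eq_zero (hθ : 1 < θ) (hn : 0 < n) {d : Data n T} {v : Fin n → ℝ}
    (hv : IsMLE θ d v) (A : Finset (Fin n)) : flow A (pairScore θ d v) = 0 := by
  refine IsLocalMax.hasDerivAt_eq_zero (Eventually.of_forall fun s => ?_)
    (hasDerivAt_logLikelihood hθ d v A)
  simpa using hv.le hn _

lemma isGain_pairScore (hθ : 1 < θ) (d : Data n T) {v w : Fin n → ℝ} {M h : ℝ}
    (hM : ∀ i j, |v i - v j| ≤ M) (h0 : 0 ≤ h) (h1 : h ≤ 1) :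
    IsGain (obsCount d) (pairScore θ d v - pairScore θ d w) (w - v) (slope θ M * h) h := by
  have key (e : Pair n) : w e.1.1 - w e.1.2 =
      (v e.1.1 - v e.1.2) + ((w - v) e.1.1 - (w - v) e.1.2) := by
    simp only [Pi.sub_apply]; ring
  have hsub (e : Pair n) : (pairScore θ d v - pairScore θ d w) e =
      ∑ t : Fin T with t.val < (d e).1, (score θ ((d e).2 t) (v e.1.1 - v e.1.2) -
        score θ ((d e).2 t) ((v e.1.1 - v e.1.2) + ((w - v) e.1.1 - (w - v) e.1.2))) := by
    simp only [Pi.sub_apply (pairScore θ d v), pairScore, key e, Finset.sum_sub_distrib]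
  constructor
  · intro e he
    rw [hsub]
    refine Finset.sum_nonneg fun t _ => ?_
    have := score_antitone hθ ((d e).2 t)
      (show v e.1.1 - v e.1.2 ≤ (v e.1.1 - v e.1.2) + ((w - v) e.1.1 - (w - v) e.1.2) by linarith)
    linarith
  · intro e he
    rw [hsub]
    refine Finset.sum_nonpos fun t _ => ?_
    have := score_antitone hθ ((d e).2 t)
      (show (v e.1.1 - v e.1.2) + ((w - v) e.1.1 - (w - v) e.1.2) ≤ v e.1.1 - v e.1.2 by linarith)
    linarith
  · intro e he
    rw [hsub, mul_comm, obsCount, ← nsmul_eq_mul]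
    exact Finset.card_nsmul_le_sum _ _ _ fun t _ =>
      slope_mul_le_score_sub hθ _ (hM _ _) h0 h1 he
  · intro e he
    rw [hsub, mul_comm, obsCount, ← mul_neg, ← nsmul_eq_mul]
    exact Finset.sum_le_card_nsmul _ _ _ fun t _ =>
      score_sub_le_neg_slope_mul hθ _ (hM _ _) h0 h1 he

/-! ### Existence and uniqueness of the maximum likelihood estimate -/

/-- Whatever the cut, some observed comparison across it is not won by the side `A`. -/
def Connects (d : Data n T) : Prop :=
  ∀ A : Finset (Fin n), A.Nonempty → A ≠ Finset.univ → ∃ e : Pair n, ∃ t : Fin T,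
    t.val < (d e).1 ∧ ((e.1.1 ∈ A ∧ e.1.2 ∉ A ∧ (d e).2 t ≠ 1) ∨
      (e.1.2 ∈ A ∧ e.1.1 ∉ A ∧ (d e).2 t ≠ -1))

/-- If `A` won every observed comparison across its boundary, each of them would add at least `slope
θ M` to the flow out of `A` at `u`. Expansion with `A' = A` would push that flow above the bound `s
|A|`. When `A` is a majority, its complement is used instead. -/
lemma connects_of_expands (hθ : 1 < θ) {d : Data n T} {u : Fin n → ℝ} {M r q s : ℝ}
    (hM : ∀ i j, |u i - u j| ≤ M) (hN : Expands (obsCount d) r q) (hr : 1 ≤ r)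
    (hs : s ≤ slope θ M * q) (hu : ∀ k, |flow {k} (pairScore θ d u)| ≤ s) : Connects d := by
  intro A hA hA'
  by_contra! hc
  have hwin : ∀ e : Pair n, e.1.1 ∈ A → e.1.2 ∉ A →
      slope θ M * obsCount d e ≤ pairScore θ d u e := by
    intro e hi hj
    rw [mul_comm, obsCount, ← nsmul_eq_mul]
    refine Finset.card_nsmul_le_sum _ _ _ fun t ht => ?_
    have : (d e).2 t = SignType.pos := ((hc e t (by simpa using ht)).1 hi hj)
    rw [this]
    exact slope_le_winScore hθ (hM _ _)
  have hlose : ∀ e : Pair n, e.1.2 ∈ A → e.1.1 ∉ A →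
      pairScore θ d u e ≤ -(slope θ M * obsCount d e) := by
    intro e hj hi
    rw [mul_comm, obsCount, ← mul_neg, ← nsmul_eq_mul]
    refine Finset.sum_le_card_nsmul _ _ _ fun t ht => ?_
    have : (d e).2 t = SignType.neg := ((hc e t (by simpa using ht)).2 hj hi)
    rw [this]
    have := slope_le_winScore hθ (M := M) (y := -(u e.1.1 - u e.1.2)) (by rw [abs_neg]; exact hM _ _)
    simp only [score]
    linarith
  have hκ := slope_pos hθ M
  have hN0 : ∀ e, 0 ≤ slope θ M * obsCount d e := fun e => by unfold obsCount; positivity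
  have hle : slope θ M * cut (obsCount d) A Aᶜ ≤ flow A (pairScore θ d u) := by
    refine mul_cut_le_flow disjoint_compl_right (fun e hi hj => (hN0 e).trans (hwin e hi hj))
      (fun e hj hi => (hlose e hj hi).trans (neg_nonpos.2 (hN0 e)))
      (fun e hi hj => hwin e hi (by simpa using hj)) (fun e hj hi => hlose e hj (by simpa using hi))
  have hcontra : ∀ B : Finset (Fin n), B.Nonempty → 2 * B.card ≤ n →
      slope θ M * cut (obsCount d) B Bᶜ ≤ s * B.card → False := by
    intro B hB hB' hcut
    have hc0 : 0 < (B.card : ℝ) := by exact_mod_cast Finset.card_pos.2 hB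
    have h1 := hN B B hB subset_rfl hB' (le_mul_of_one_le_left hc0.le hr)
    have h2 : slope θ M * (q * B.card) < slope θ M * cut (obsCount d) B Bᶜ := by gcongr
    have h3 : s * B.card ≤ slope θ M * q * B.card := by gcongr
    linarith
  by_cases hcard : 2 * A.card ≤ n
  · exact hcontra A hA hcard (hle.trans ((le_abs_self _).trans (abs_flow_le hu A)))
  · have hcc := Finset.card_compl A
    rw [Fintype.card_fin] at hcc
    refine hcontra Aᶜ ?_ (by omega) ?_
    · rw [Finset.nonempty_iff_ne_empty]
      simpa using hA'
    · rw [compl_compl, cut_comm]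
      refine hle.trans ?_
      have h1 := flow_compl A (pairScore θ d u)
      have h2 := (abs_le.1 (abs_flow_le hu Aᶜ)).1
      linarith

lemma log_link_nonpos (hθ : 1 < θ) (x : SignType) (y : ℝ) : Real.log (link θ x y) ≤ 0 :=
  Real.log_nonpos (link_pos hθ x y).le (link_le_one hθ x y)

lemma logLikelihood_le_log_link (hθ : 1 < θ) (d : Data n T) (v : Fin n → ℝ) {e : Pair n}
    {t : Fin T} (ht : t.val < (d e).1) :
    logLikelihood θ d v ≤ Real.log (link θ ((d e).2 t) (v e.1.1 - v e.1.2)) := by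
  have h1 : ∀ e : Pair n, ∑ t : Fin T with t.val < (d e).1,
      Real.log (link θ ((d e).2 t) (v e.1.1 - v e.1.2)) ≤ 0 :=
    fun e => Finset.sum_nonpos fun t _ => log_link_nonpos hθ _ _
  unfold logLikelihood
  rw [← Finset.add_sum_erase _ _ (Finset.mem_univ e)]
  have h2 := Finset.sum_nonpos (s := Finset.univ.erase e) fun e _ => h1 e
  rw [← Finset.add_sum_erase _ _ (show t ∈ Finset.univ.filter (fun t : Fin T => t.val < (d e).1) by
    simpa using ht)]
  have h3 := Finset.sum_nonpos (s := (Finset.univ.filter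
    (fun t : Fin T => t.val < (d e).1)).erase t) fun t _ =>
      log_link_nonpos hθ ((d e).2 t) (v e.1.1 - v e.1.2)
  linarith

/-- All terms of the log-likelihood are nonpositive, so each is at least `-L`. A comparison not won
by a member of a level set then places its outside opponent at most `H` lower. The level sets at
spacing `H` thus grow strictly and exhaust all subjects within `n` steps. -/
lemma Connects.sub_le (hθ : 1 < θ) {d : Data n T} (hd : Connects d) {v : Fin n → ℝ} {L : ℝ}
    (hL : -L ≤ logLikelihood θ d v) (hL0 : 0 ≤ L) (i j : Fin n) :
    v i - v j ≤ n * (Real.log θ + L) := by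
  set H := Real.log θ + L with hH
  have hH0 : 0 ≤ H := add_nonneg (Real.log_nonneg hθ.le) hL0
  set B : ℕ → Finset (Fin n) := fun k => Finset.univ.filter fun j => v i - k * H ≤ v j with hB
  have mem (k : ℕ) (j : Fin n) : j ∈ B k ↔ v i - k * H ≤ v j := by simp [hB]
  have hi0 : ∀ k, i ∈ B k := fun k => by
    rw [mem]
    have : 0 ≤ (k : ℝ) * H := by positivity
    linarith
  have hmono : ∀ k, B k ⊆ B (k + 1) := by
    intro k j hj
    rw [mem] at hj ⊢
    push_cast
    linarith
  have hstep : ∀ k, B k ≠ Finset.univ → B k ⊂ B (k + 1) := by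
    intro k hk
    refine (Finset.ssubset_iff_of_subset (hmono k)).2 ?_
    obtain ⟨e, t, ht, h⟩ := hd (B k) ⟨i, hi0 k⟩ hk
    have hl := hL.trans (logLikelihood_le_log_link hθ d v ht)
    rcases h with ⟨hi, hj, hx⟩ | ⟨hj, hi, hx⟩
    · refine ⟨e.1.2, ?_, hj⟩
      have := log_link_le_of_ne_pos hθ hx (v e.1.1 - v e.1.2)
      rw [mem] at hi ⊢
      push_cast
      linarith
    · refine ⟨e.1.1, ?_, hi⟩
      have := log_link_le_of_ne_neg hθ hx (v e.1.1 - v e.1.2)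
      rw [mem] at hj ⊢
      push_cast
      linarith
  have hcard : ∀ k, B k = Finset.univ ∨ k < (B k).card := by
    intro k
    induction k with
    | zero => exact Or.inr (Finset.card_pos.2 ⟨i, hi0 0⟩)
    | succ k ih =>
      by_cases hk : B k = Finset.univ
      · exact Or.inl (Finset.univ_subset_iff.1 (hk ▸ hmono k))
      · have := Finset.card_lt_card (hstep k hk)
        have := ih.resolve_left hk
        exact Or.inr (by omega)
  have hall : B n = Finset.univ := by
    refine (hcard n).resolve_right fun h => ?_
    have := Finset.card_le_univ (B n)
    rw [Fintype.card_fin] at this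
    omega
  have := (mem n j).1 (hall ▸ Finset.mem_univ j)
  linarith

lemma Connects.exists_isMLE (hθ : 1 < θ) (hn : 0 < n) {d : Data n T} (hd : Connects d) :
    ∃ v, IsMLE θ d v := by
  set R : ℝ := n * (Real.log θ + -logLikelihood θ d 0) with hR
  have hL0 : 0 ≤ -logLikelihood θ d 0 := by
    rw [neg_nonneg]
    exact Finset.sum_nonpos fun e _ => Finset.sum_nonpos fun t _ => log_link_nonpos hθ _ _
  have hR0 : 0 ≤ R := by
    have := Real.log_nonneg hθ.le
    positivity
  -- Points at least as likely as `0` lie in a fixed box, so a maximizer over the compact normalized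
  -- box is global.
  have hbox : ∀ w ∈ normalized n, logLikelihood θ d 0 ≤ logLikelihood θ d w →
      w ∈ Set.Icc (fun _ => -R) (fun _ => R) := by
    intro w hw h
    have h0 : w ⟨0, hn⟩ = 0 := hw _ rfl
    constructor <;> intro i
    · have := hd.sub_le hθ (by simpa using h) hL0 ⟨0, hn⟩ i
      simp only at this ⊢
      linarith
    · have := hd.sub_le hθ (by simpa using h) hL0 i ⟨0, hn⟩
      simp only at this ⊢
      linarith
  have hclosed : IsClosed (normalized n) := by
    have : normalized n = ⋂ i : Fin n, {v : Fin n → ℝ | i.val = 0 → v i = 0} := by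
      ext v; simp [normalized]
    rw [this]
    refine isClosed_iInter fun i => ?_
    by_cases hi : i.val = 0
    · simpa [hi] using isClosed_eq (continuous_apply i) continuous_const
    · simp [hi]
  have h0 : (0 : Fin n → ℝ) ∈ normalized n := fun _ _ => rfl
  obtain ⟨v, hv, hmax⟩ := (isCompact_Icc.inter_left hclosed).exists_isMaxOn
    ⟨0, h0, hbox 0 h0 le_rfl⟩ (continuous_logLikelihood hθ d).continuousOn
  refine ⟨v, hv.1, fun w hw => ?_⟩
  by_cases h : logLikelihood θ d 0 ≤ logLikelihood θ d w
  · exact hmax ⟨hw, hbox w hw h⟩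
  · exact (not_le.1 h).le.trans (hmax ⟨h0, hbox 0 h0 le_rfl⟩)

lemma abs_sub_le_dynamicRange (u : Fin n → ℝ) (i j : Fin n) : |u i - u j| ≤ dynamicRange u :=
  le_ciSup (f := fun e : Fin n × Fin n => |u e.1 - u e.2|) (Set.finite_range _).bddAbove (i, j)

/-- On the event that the comparison graph expands and the scores at the truth are small, the
maximum likelihood estimate exists, is unique and is close to the truth. -/
theorem exists_unique_isMLE_of_expands (hθ : 1 < θ) (hn : 0 < n) {d : Data n T} {u : Fin n → ℝ}
    (hu : u ∈ normalized n) {h r q s : ℝ} {K : ℕ} (h0 : 0 < h) (h1 : h ≤ 1) (hr : 1 ≤ r)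
    (hq : 0 ≤ q) (hs : s ≤ slope θ (dynamicRange u) * h * q) (hK : (n : ℝ) ≤ r ^ K)
    (hN : Expands (obsCount d) r q) (hflow : ∀ k, |flow {k} (pairScore θ d u)| ≤ s) :
    ∃ v : Fin n → ℝ, IsMLE θ d v ∧ (∀ w, IsMLE θ d w → w = v) ∧ ‖v - u‖ ≤ 2 * K * h := by
  have hconn : Connects d := by
    refine connects_of_expands hθ (abs_sub_le_dynamicRange u) hN hr (hs.trans ?_) hflow
    have := slope_pos hθ (dynamicRange u)
    gcongr
    exact mul_le_of_le_one_right this.le h1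
  obtain ⟨v, hv⟩ := hconn.exists_isMLE hθ hn
  refine ⟨v, hv, fun w hw => ?_, ?_⟩
  -- Both flows vanish, so the spread estimate applies with `s = 0` and every step size `ε ≤ 1`;
  -- letting `ε → 0` makes `w - v` constant.
  · have hε : ∀ ε : ℝ, 0 < ε → ε ≤ 1 → ∀ i j, (w - v) i - (w - v) j ≤ 2 * K * ε := by
      intro ε e0 e1
      refine (isGain_pairScore hθ d (abs_sub_le_dynamicRange v) e0.le e1).sub_le (s := 0)
        (mul_pos (slope_pos hθ _) e0) e0.le hN hr ?_ (fun A => ?_) hK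
      · have := slope_pos hθ (dynamicRange v)
        positivity
      · rw [flow_sub, hv.flow_eq_zero hθ hn, hw.flow_eq_zero hθ hn]
        simp
    have hle : ∀ i j, (w - v) i - (w - v) j ≤ 0 := by
      intro i j
      have ht : Tendsto (fun ε : ℝ => 2 * K * ε) (𝓝[>] 0) (𝓝 0) := by
        have : Tendsto (fun ε : ℝ => 2 * K * ε) (𝓝 0) (𝓝 (2 * K * 0)) :=
          tendsto_const_nhds.mul tendsto_id
        rw [mul_zero] at this
        exact this.mono_left nhdsWithin_le_nhds
      refine ge_of_tendsto ht ?_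
      filter_upwards [Ioc_mem_nhdsGT (zero_lt_one (α := ℝ))] with ε hεm
      exact hε ε hεm.1 hεm.2 i j
    ext i
    have a1 := hle i ⟨0, hn⟩
    have a2 := hle ⟨0, hn⟩ i
    have a3 : v ⟨0, hn⟩ = 0 := hv.1 _ rfl
    have a4 : w ⟨0, hn⟩ = 0 := hw.1 _ rfl
    simp only [Pi.sub_apply] at a1 a2
    linarith
  · have hle : ∀ i j, (v - u) i - (v - u) j ≤ 2 * K * h := by
      refine (isGain_pairScore hθ d (abs_sub_le_dynamicRange u) h0.le h1).sub_le
        (mul_pos (slope_pos hθ _) h0) h0.le hN hr hs (fun A => ?_) hK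
      rw [flow_sub, hv.flow_eq_zero hθ hn, sub_zero]
      exact abs_flow_le hflow A
    refine (pi_norm_le_iff_of_nonneg (by positivity)).2 fun i => ?_
    have a1 := hle i ⟨0, hn⟩
    have a2 := hle ⟨0, hn⟩ i
    have a3 : v ⟨0, hn⟩ = 0 := hv.1 _ rfl
    have a4 : u ⟨0, hn⟩ = 0 := hu _ rfl
    simp only [Pi.sub_apply] at a1 a2 ⊢
    rw [Real.norm_eq_abs, abs_le]
    constructor <;> linarith

/-! ### Exponential moments and tail bounds -/

/-- The exponential moment of a statistic of a single comparison. -/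
def expMoment (θ y : ℝ) (φ : SignType → ℝ) : ℝ := ∑ x : SignType, link θ x y * Real.exp (φ x)

lemma sum_signType (f : SignType → ℝ) : ∑ x : SignType, f x = f .neg + f .zero + f .pos := by
  have : (Finset.univ : Finset SignType) = {.neg, .zero, .pos} := by decide
  rw [this, Finset.sum_insert (by decide), Finset.sum_insert (by decide), Finset.sum_singleton]
  ring

lemma sum_link (hθ : 1 < θ) (y : ℝ) : ∑ x : SignType, link θ x y = 1 := by
  rw [sum_signType, link_sum hθ]

lemma isProbabilityMeasure_outcomeLaw (hθ : 1 < θ) (y : ℝ) :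
    IsProbabilityMeasure (outcomeLaw θ y) := by
  constructor
  unfold outcomeLaw
  simp only [Measure.finsetSum_apply, Measure.smul_apply, measure_univ, smul_eq_mul, mul_one]
  rw [← ENNReal.ofReal_sum_of_nonneg fun x _ => (link_pos hθ x y).le, sum_link hθ,
    ENNReal.ofReal_one]

lemma integral_outcomeLaw (hθ : 1 < θ) (y : ℝ) (f : SignType → ℝ) :
    ∫ x, f x ∂outcomeLaw θ y = ∑ x : SignType, link θ x y * f x := by
  unfold outcomeLaw
  rw [integral_finsetSum_measure fun x _ => Integrable.of_finite.smul_measure ENNReal.ofReal_ne_top]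
  refine Finset.sum_congr rfl fun x _ => ?_
  rw [integral_smul_measure, integral_dirac, ENNReal.toReal_ofReal (link_pos hθ x y).le, smul_eq_mul]


lemma integral_binomial_pow (p : unitInterval) (m : ℝ) :
    ∫ k, m ^ (Finset.univ.filter fun t : Fin T => t.val < k).card ∂binomial T p =
      (1 - p + p * m) ^ T := by
  rw [integral_binomial, add_comm (1 - (p : ℝ)), add_pow, Nat.range_succ_eq_Iic]
  refine Finset.sum_congr rfl fun k hk => ?_
  rw [Fin.card_filter_val_lt, min_eq_right (Finset.mem_Iic.1 hk), mul_pow, smul_eq_mul]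
  ring

lemma integral_exp_edge (hθ : 1 < θ) (p : unitInterval) (y : ℝ) (φ : SignType → ℝ) :
    ∫ z : ℕ × (Fin T → SignType), Real.exp (∑ t : Fin T with t.val < z.1, φ (z.2 t))
      ∂((binomial T p).prod (Measure.pi fun _ : Fin T => outcomeLaw θ y)) =
      (1 - p + p * expMoment θ y φ) ^ T := by
  have := isProbabilityMeasure_outcomeLaw hθ y
  -- Given the number of comparisons, the outcomes are independent; averaging over that number gives
  -- the binomial generating function.
  rw [integral_prod, ← integral_binomial_pow]
  · refine integral_congr_ae (Eventually.of_forall fun k => ?_)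
    have h1 : ∀ x : Fin T → SignType, Real.exp (∑ t : Fin T with t.val < k, φ (x t)) =
        ∏ t : Fin T, if t.val < k then Real.exp (φ (x t)) else 1 := by
      intro x
      rw [Real.exp_sum, Finset.prod_filter]
    simp only [h1]
    rw [integral_fintype_prod_eq_prod
      (f := fun (t : Fin T) (x : SignType) => if t.val < k then Real.exp (φ x) else 1),
      ← Finset.prod_const, Finset.prod_filter]
    refine Finset.prod_congr rfl fun t _ => ?_
    split_ifs with h
    · rw [integral_outcomeLaw hθ, expMoment]
    · simp
  · refine Integrable.of_bound (Measurable.of_discrete).aestronglyMeasurable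
      (Real.exp (T * ∑ x : SignType, |φ x|)) (Eventually.of_forall fun z => ?_)
    rw [Real.norm_of_nonneg (Real.exp_pos _).le]
    refine Real.exp_le_exp.2 ?_
    calc ∑ t : Fin T with t.val < z.1, φ (z.2 t)
        ≤ ∑ t : Fin T with t.val < z.1, ∑ x : SignType, |φ x| :=
          Finset.sum_le_sum fun t _ => (le_abs_self _).trans
            (Finset.single_le_sum (f := fun x => |φ x|) (fun x _ => abs_nonneg _)
              (Finset.mem_univ _))
      _ ≤ ∑ t : Fin T, ∑ x : SignType, |φ x| :=
          Finset.sum_le_sum_of_subset_of_nonneg (Finset.filter_subset _ _)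
            fun _ _ _ => Finset.sum_nonneg fun _ _ => abs_nonneg _
      _ = _ := by simp

instance discreteMeasurableSpace_data : DiscreteMeasurableSpace (Data n T) := by
  have h1 : Countable (Data n T) := inferInstance
  have h2 : MeasurableSingletonClass (Data n T) := inferInstance
  infer_instance

lemma isProbabilityMeasure_dataLaw (hθ : 1 < θ) (p : unitInterval) (u : Fin n → ℝ) :
    IsProbabilityMeasure (dataLaw θ T p u) := by
  have := fun y => isProbabilityMeasure_outcomeLaw hθ y
  unfold dataLaw
  infer_instance

/-- Chernoff's bound for additive statistics of the observed comparisons. -/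
lemma dataLaw_real_le_exp_mul_prod (hθ : 1 < θ) (p : unitInterval) (u : Fin n → ℝ)
    (φ : Pair n → SignType → ℝ) (c : ℝ) :
    (dataLaw θ T p u).real
      {d | c ≤ ∑ e : Pair n, ∑ t : Fin T with t.val < (d e).1, φ e ((d e).2 t)} ≤
    Real.exp (-c) *
      ∏ e : Pair n, (1 - p + p * expMoment θ (u e.1.1 - u e.1.2) (φ e)) ^ T := by
  have := fun y => isProbabilityMeasure_outcomeLaw hθ y
  have := isProbabilityMeasure_dataLaw (T := T) hθ p u
  set X : Data n T → ℝ :=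
    fun d => ∑ e : Pair n, ∑ t : Fin T with t.val < (d e).1, φ e ((d e).2 t) with hX
  have hint : Integrable (fun d => Real.exp (1 * X d)) (dataLaw θ T p u) := by
    refine Integrable.of_bound (Measurable.of_discrete).aestronglyMeasurable
      (Real.exp (∑ e : Pair n, ∑ t : Fin T, ∑ x : SignType, |φ e x|))
      (Eventually.of_forall fun d => ?_)
    rw [Real.norm_of_nonneg (Real.exp_pos _).le, one_mul]
    refine Real.exp_le_exp.2 (Finset.sum_le_sum fun e _ => ?_)
    calc ∑ t : Fin T with t.val < (d e).1, φ e ((d e).2 t)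
        ≤ ∑ t : Fin T with t.val < (d e).1, ∑ x : SignType, |φ e x| :=
          Finset.sum_le_sum fun t _ => (le_abs_self _).trans
            (Finset.single_le_sum (f := fun x => |φ e x|) (fun x _ => abs_nonneg _)
              (Finset.mem_univ _))
      _ ≤ ∑ t : Fin T, ∑ x : SignType, |φ e x| :=
          Finset.sum_le_sum_of_subset_of_nonneg (Finset.filter_subset _ _)
            fun _ _ _ => Finset.sum_nonneg fun _ _ => abs_nonneg _
  -- The exponential parameter is 1 because any tilt is already contained in `φ`.
  have h := measure_ge_le_exp_mul_mgf c zero_le_one hint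
  rw [neg_one_mul] at h
  refine h.trans (le_of_eq ?_)
  congr 1
  unfold mgf dataLaw
  simp only [one_mul, hX, Real.exp_sum (s := (Finset.univ : Finset (Pair n)))]
  rw [integral_fintype_prod_eq_prod (f := fun (e : Pair n) (z : ℕ × (Fin T → SignType)) =>
    Real.exp (∑ t : Fin T with t.val < z.1, φ e (z.2 t)))]
  exact Finset.prod_congr rfl fun e _ => integral_exp_edge hθ p _ _

lemma card_cutPairs {A C : Finset (Fin n)} (h : Disjoint A C) :
    (cutPairs A C).card = A.card * C.card := by
  have hne : ∀ i ∈ A, i ∉ C := fun i hi => Finset.disjoint_left.1 h hi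
  rw [← Finset.card_product]
  -- Each pair is reoriented to put its member in `A` first.
  refine Finset.card_bij (fun e _ => if e.1.1 ∈ A then e.1 else (e.1.2, e.1.1)) ?_ ?_ ?_
  · intro e he
    rw [mem_cutPairs] at he
    by_cases hi : e.1.1 ∈ A
    · have : e.1.2 ∈ C := he.elim (fun h => h.2) fun h => absurd h.2 (hne _ hi)
      simp [hi, this]
    · have := he.resolve_left fun h => hi h.1
      simp [hi, this]
  · rintro ⟨⟨i, j⟩, hij⟩ he ⟨⟨k, l⟩, hkl⟩ he' heq
    rw [mem_cutPairs] at he he'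
    simp only at he he' heq hij hkl
    split_ifs at heq with h1 h2 h2
    · exact Subtype.ext heq
    · simp only [Prod.mk.injEq] at heq
      omega
    · simp only [Prod.mk.injEq] at heq
      omega
    · simp only [Prod.mk.injEq] at heq
      simp [heq]
  · rintro ⟨i, j⟩ hij
    rw [Finset.mem_product] at hij
    simp only at hij
    have hji : j ∉ A := fun hj => hne _ hj hij.2
    have hij' : i ≠ j := fun h => hji (h ▸ hij.1)
    rcases lt_or_gt_of_ne hij' with hlt | hlt
    · exact ⟨⟨(i, j), hlt⟩, mem_cutPairs.2 (Or.inl hij), by simp [hij.1]⟩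
    · exact ⟨⟨(j, i), hlt⟩, mem_cutPairs.2 (Or.inr hij), by simp [hji]⟩

/-- Lower tail of the number of comparisons between two sets of subjects. -/
lemma dataLaw_real_cut_le (hθ : 1 < θ) (hT : 1 ≤ T) (p : unitInterval) (u : Fin n → ℝ)
    {A C : Finset (Fin n)} (h : Disjoint A C) (c : ℝ) :
    (dataLaw θ T p u).real {d | cut (obsCount d) A C ≤ c} ≤
      Real.exp (c - p / 2 * (A.card * C.card)) := by
  have hp0 := p.2.1
  have hp1 := p.2.2
  set φ : Pair n → SignType → ℝ := fun e _ => if e ∈ cutPairs A C then -1 else 0 with hφ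
  have hcut : ∀ d : Data n T, -cut (obsCount d) A C =
      ∑ e : Pair n, ∑ t : Fin T with t.val < (d e).1, φ e ((d e).2 t) := by
    intro d
    unfold cut obsCount
    simp only [hφ, Finset.sum_const, nsmul_eq_mul, mul_ite, mul_neg, mul_one, mul_zero]
    rw [Finset.sum_ite_mem, Finset.univ_inter, Finset.sum_neg_distrib]
  have hset : {d : Data n T | cut (obsCount d) A C ≤ c} =
      {d | -c ≤ ∑ e : Pair n, ∑ t : Fin T with t.val < (d e).1, φ e ((d e).2 t)} := by
    ext d
    simp only [Set.mem_ofPred_eq, ← hcut d]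
    exact neg_le_neg_iff.symm
  rw [hset]
  refine (dataLaw_real_le_exp_mul_prod hθ p u φ (-c)).trans ?_
  rw [neg_neg, sub_eq_add_neg c, Real.exp_add]
  gcongr
  have hexp : Real.exp (-1) ≤ 1 / 2 := by
    rw [Real.exp_neg, one_div]
    gcongr
    linarith [Real.add_one_le_exp (1 : ℝ)]
  have hfac : ∀ e : Pair n, (1 - p + p * expMoment θ (u e.1.1 - u e.1.2) (φ e)) ^ T ≤
      if e ∈ cutPairs A C then Real.exp (-(p / 2)) else 1 := by
    intro e
    have hm : expMoment θ (u e.1.1 - u e.1.2) (φ e) =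
        Real.exp (if e ∈ cutPairs A C then -1 else 0) := by
      simp only [expMoment, hφ]
      rw [← Finset.sum_mul, sum_link hθ, one_mul]
    rw [hm]
    split_ifs with he
    · have h0 : 0 ≤ 1 - (p : ℝ) + p * Real.exp (-1) := by
        have := Real.exp_pos (-1)
        have : 0 ≤ (p : ℝ) * Real.exp (-1) := by positivity
        linarith
      have h1 : 1 - (p : ℝ) + p * Real.exp (-1) ≤ 1 - p / 2 := by nlinarith
      -- One potential comparison per pair already suffices, so the power `T ≥ 1` is reduced to 1.
      calc (1 - (p : ℝ) + p * Real.exp (-1)) ^ T ≤ (1 - (p : ℝ) + p * Real.exp (-1)) ^ 1 :=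
            pow_le_pow_of_le_one h0 (by linarith) hT
        _ ≤ 1 - p / 2 := by rwa [pow_one]
        _ ≤ _ := Real.one_sub_le_exp_neg _
    · simp
  calc ∏ e : Pair n, (1 - (p : ℝ) + p * expMoment θ (u e.1.1 - u e.1.2) (φ e)) ^ T
      ≤ ∏ e : Pair n, if e ∈ cutPairs A C then Real.exp (-(p / 2)) else 1 := by
        refine Finset.prod_le_prod (fun e _ => ?_) fun e _ => hfac e
        have : 0 ≤ expMoment θ (u e.1.1 - u e.1.2) (φ e) :=
          Finset.sum_nonneg fun x _ => mul_nonneg (link_pos hθ x _).le (Real.exp_pos _).le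
        have : 0 ≤ 1 - (p : ℝ) := by linarith
        positivity
    _ = Real.exp (-(p / 2)) ^ (A.card * C.card) := by
        rw [Finset.prod_ite_mem, Finset.univ_inter, Finset.prod_const, card_cutPairs h]
    _ = Real.exp (-(p / 2 * (A.card * C.card))) := by
        rw [← Real.exp_nat_mul]
        congr 1
        push_cast
        ring

/-- Use `e^x ≤ 1 + x + x²` for `|x| ≤ 1`: the linear term has mean zero and `|score| ≤ 1`. -/
lemma expMoment_score_le (hθ : 1 < θ) (y : ℝ) {τ : ℝ} (hτ : |τ| ≤ 1) :
    expMoment θ y (fun x => τ * score θ x y) ≤ 1 + τ ^ 2 := by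
  have hterm : ∀ x : SignType, link θ x y * Real.exp (τ * score θ x y) ≤
      link θ x y + τ * (link θ x y * score θ x y) + τ ^ 2 * link θ x y := by
    intro x
    have hs := abs_score_le_one hθ x y
    have h1 : |τ * score θ x y| ≤ 1 := by
      rw [abs_mul]; exact mul_le_one₀ hτ (abs_nonneg _) hs
    have h2 := (abs_le.1 (Real.abs_exp_sub_one_sub_id_le h1)).2
    have h3 : (τ * score θ x y) ^ 2 ≤ τ ^ 2 := by
      rw [mul_pow]
      exact mul_le_of_le_one_right (sq_nonneg _) ((sq_le_one_iff_abs_le_one _).2 hs)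
    have h4 : Real.exp (τ * score θ x y) ≤ 1 + τ * score θ x y + τ ^ 2 := by linarith
    calc link θ x y * Real.exp (τ * score θ x y)
        ≤ link θ x y * (1 + τ * score θ x y + τ ^ 2) :=
          mul_le_mul_of_nonneg_left h4 (link_pos hθ x y).le
      _ = _ := by ring
  calc expMoment θ y (fun x => τ * score θ x y)
      ≤ ∑ x : SignType, (link θ x y + τ * (link θ x y * score θ x y) + τ ^ 2 * link θ x y) :=
        Finset.sum_le_sum fun x _ => hterm x
    _ = 1 + τ ^ 2 := by
        rw [Finset.sum_add_distrib, Finset.sum_add_distrib, ← Finset.mul_sum, ← Finset.mul_sum,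
          sum_link hθ, sum_signType (fun x => link θ x y * score θ x y), link_mul_score_sum hθ]
        ring

/-- Tail bound for the score of one subject at the true parameter. -/
lemma dataLaw_real_le_flow (hθ : 1 < θ) (p : unitInterval) (u : Fin n → ℝ) (k : Fin n)
    {σ ε : ℝ} (hσ0 : 0 ≤ σ) (hσ : σ ≤ 1) (hε : |ε| = 1) (s : ℝ) :
    (dataLaw θ T p u).real {d | s ≤ ε * flow {k} (pairScore θ d u)} ≤
      Real.exp (T * σ ^ 2 * (n * p) - σ * s) := by
  have := isProbabilityMeasure_dataLaw (T := T) hθ p u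
  have hp0 := p.2.1
  have hp1 := p.2.2
  -- The tilt is `±σ` on the pairs containing `k` and zero elsewhere; `ε = ±1` selects the tail.
  set τ : Pair n → ℝ := fun e => σ * ε * (ind {k} e.1.1 - ind {k} e.1.2) with hτdef
  set φ : Pair n → SignType → ℝ := fun e x => τ e * score θ x (u e.1.1 - u e.1.2) with hφ
  have hε2 : ε ^ 2 = 1 := by rw [← sq_abs, hε, one_pow]
  have hτ2 : ∀ e, τ e ^ 2 = if e ∈ cutPairs {k} {k}ᶜ then σ ^ 2 else 0 := by
    intro e
    have hne := e.2.ne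
    have m := @mem_cutPairs n {k} {k}ᶜ e
    simp only [Finset.mem_singleton, Finset.mem_compl] at m
    simp only [hτdef, mul_pow, hε2, mul_one]
    by_cases hi : e.1.1 = k <;> by_cases hj : e.1.2 = k
    · exact absurd (hi.trans hj.symm) hne
    · have : e ∈ cutPairs {k} {k}ᶜ := m.2 (Or.inl ⟨hi, hj⟩)
      simp [ind, hi, hj, this]
    · have : e ∈ cutPairs {k} {k}ᶜ := m.2 (Or.inr ⟨hj, hi⟩)
      simp [ind, hi, hj, this]
    · have : e ∉ cutPairs {k} {k}ᶜ := by rw [m]; tauto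
      simp [ind, hi, hj, this]
  have hτ1 : ∀ e, |τ e| ≤ 1 := by
    intro e
    rw [← sq_le_one_iff_abs_le_one, hτ2]
    split_ifs
    · exact pow_le_one₀ hσ0 hσ
    · exact zero_le_one
  have hflow : ∀ d : Data n T, σ * (ε * flow {k} (pairScore θ d u)) =
      ∑ e : Pair n, ∑ t : Fin T with t.val < (d e).1, φ e ((d e).2 t) := by
    intro d
    unfold flow pairScore
    rw [Finset.mul_sum, Finset.mul_sum]
    refine Finset.sum_congr rfl fun e _ => ?_
    simp only [hφ, hτdef]
    rw [← Finset.mul_sum]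
    ring
  have hsub : {d : Data n T | s ≤ ε * flow {k} (pairScore θ d u)} ⊆
      {d | σ * s ≤ ∑ e : Pair n, ∑ t : Fin T with t.val < (d e).1, φ e ((d e).2 t)} := by
    intro d hd
    simp only [Set.mem_ofPred_eq, ← hflow d] at hd ⊢
    gcongr
  refine (measureReal_mono hsub).trans ((dataLaw_real_le_exp_mul_prod hθ p u φ _).trans ?_)
  rw [sub_eq_neg_add _ (σ * s), Real.exp_add]
  gcongr
  have hfac : ∀ e : Pair n, (1 - (p : ℝ) + p * expMoment θ (u e.1.1 - u e.1.2) (φ e)) ^ T ≤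
      Real.exp (T * (p * τ e ^ 2)) := by
    intro e
    have h0 : 0 ≤ expMoment θ (u e.1.1 - u e.1.2) (φ e) :=
      Finset.sum_nonneg fun x _ => mul_nonneg (link_pos hθ x _).le (Real.exp_pos _).le
    have h1 : 0 ≤ 1 - (p : ℝ) := by linarith
    have h2 := expMoment_score_le hθ (u e.1.1 - u e.1.2) (hτ1 e)
    rw [Real.exp_nat_mul]
    refine pow_le_pow_left₀ (by positivity) ?_ T
    have h3 : (p : ℝ) * expMoment θ (u e.1.1 - u e.1.2) (φ e) ≤ p * (1 + τ e ^ 2) := by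
      gcongr
    linarith [Real.add_one_le_exp ((p : ℝ) * τ e ^ 2)]
  calc ∏ e : Pair n, (1 - (p : ℝ) + p * expMoment θ (u e.1.1 - u e.1.2) (φ e)) ^ T
      ≤ ∏ e : Pair n, Real.exp (T * (p * τ e ^ 2)) := by
        refine Finset.prod_le_prod (fun e _ => ?_) fun e _ => hfac e
        have : 0 ≤ expMoment θ (u e.1.1 - u e.1.2) (φ e) :=
          Finset.sum_nonneg fun x _ => mul_nonneg (link_pos hθ x _).le (Real.exp_pos _).le
        have : 0 ≤ 1 - (p : ℝ) := by linarith
        positivity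
    _ = Real.exp (T * (p * ∑ e : Pair n, τ e ^ 2)) := by
        rw [← Real.exp_sum, Finset.mul_sum, Finset.mul_sum]
    _ ≤ _ := by
        refine Real.exp_le_exp.2 ?_
        have h1 : ∑ e : Pair n, τ e ^ 2 = ((cutPairs {k} {k}ᶜ : Finset (Pair n)).card : ℝ) * σ ^ 2 := by
          simp only [hτ2]
          rw [Finset.sum_ite_mem, Finset.univ_inter, Finset.sum_const, nsmul_eq_mul]
        have h2 : ((cutPairs {k} {k}ᶜ : Finset (Pair n)).card : ℝ) ≤ n := by
          rw [card_cutPairs disjoint_compl_right, Finset.card_singleton, one_mul]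
          exact_mod_cast (Finset.card_le_univ _).trans_eq (Fintype.card_fin n)
        rw [h1]
        calc (T : ℝ) * (p * (((cutPairs {k} {k}ᶜ : Finset (Pair n)).card : ℝ) * σ ^ 2))
            ≤ T * (p * (n * σ ^ 2)) := by gcongr
          _ = _ := by ring

/-- Weights `n^{-|A|}` make a union bound over all subsets affordable: their sum is `(1 + 1/n)^n`.
-/
lemma sum_inv_pow_card_le (hn : 0 < n) :
    ∑ A : Finset (Fin n), ((n : ℝ)⁻¹) ^ A.card ≤ 3 := by
  have h := Fin.sum_pow_mul_eq_add_pow (n := n) ((n : ℝ)⁻¹) 1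
  simp only [one_pow, mul_one] at h
  rw [h]
  calc ((n : ℝ)⁻¹ + 1) ^ n ≤ Real.exp ((n : ℝ)⁻¹) ^ n := by
        gcongr; exact Real.add_one_le_exp _
    _ = Real.exp 1 := by
        rw [← Real.exp_nat_mul, mul_inv_cancel₀ (by positivity)]
    _ ≤ 3 := by linarith [Real.exp_one_lt_d9]

/-- The comparison graph expands with high probability. -/
lemma dataLaw_real_not_expands_le (hθ : 1 < θ) (hT : 1 ≤ T) (p : unitInterval) (u : Fin n → ℝ)
    (hn : 2 ≤ n) (hp : 64 * Real.log n ≤ n * p) :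
    (dataLaw θ T p u).real
      {d | ¬ Expands (obsCount d) (n * p / (64 * Real.log n)) (n * p / 8)} ≤ 9 / (n : ℝ) ^ 3 := by
  have := isProbabilityMeasure_dataLaw (T := T) hθ p u
  have hn0 : (0 : ℝ) < n := by positivity
  have hL : 0 < Real.log n := Real.log_pos (by exact_mod_cast hn)
  set X : ℝ := n * p with hX
  have hX0 : 0 ≤ X := mul_nonneg hn0.le p.2.1
  set S : Finset (Finset (Fin n) × Finset (Fin n)) := Finset.univ.filter fun Q =>
    Q.1.Nonempty ∧ Q.1 ⊆ Q.2 ∧ 2 * Q.2.card ≤ n ∧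
      (Q.2.card : ℝ) ≤ X / (64 * Real.log n) * Q.1.card with hS
  have hsub : {d : Data n T | ¬ Expands (obsCount d) (X / (64 * Real.log n)) (X / 8)} ⊆
      ⋃ Q ∈ S, {d | cut (obsCount d) Q.1 Q.2ᶜ ≤ X / 8 * Q.1.card} := by
    intro d hd
    simp only [Set.mem_ofPred_eq, Expands] at hd
    push Not at hd
    obtain ⟨A, A', h1, h2, h3, h4, h5⟩ := hd
    simp only [Set.mem_iUnion]
    exact ⟨(A, A'), by simp [hS, h1, h2, h3, h4], h5⟩
  -- Since `|A'ᶜ| ≥ n/2`, the tail is at most `exp (-X |A| / 8)`. The size constraint gives `log n *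
  -- |A'| ≤ X |A| / 64`. The same bound holds for `log n * |A|` and `log n`, so the required
  -- exponent is at most `5 X |A| / 64`.
  have hbound : ∀ Q ∈ S, (dataLaw θ T p u).real
      {d | cut (obsCount d) Q.1 Q.2ᶜ ≤ X / 8 * Q.1.card} ≤
      ((n : ℝ)⁻¹) ^ 3 * (((n : ℝ)⁻¹) ^ Q.1.card * ((n : ℝ)⁻¹) ^ Q.2.card) := by
    rintro ⟨A, A'⟩ hQ
    simp only [hS, Finset.mem_filter, Finset.mem_univ, true_and] at hQ ⊢
    obtain ⟨h1, h2, h3, h4⟩ := hQ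
    have hdisj : Disjoint A A'ᶜ := by
      rw [Finset.disjoint_left]
      intro i hi
      simpa using h2 hi
    have ha : (1 : ℝ) ≤ A.card := by exact_mod_cast Finset.card_pos.2 h1
    have hc : (n : ℝ) / 2 ≤ (A'ᶜ.card : ℝ) := by
      have h3' : (2 : ℝ) * A'.card ≤ n := by exact_mod_cast h3
      rw [Finset.card_compl, Fintype.card_fin, Nat.cast_sub (by omega)]
      linarith
    refine (dataLaw_real_cut_le hθ hT p u hdisj _).trans ?_
    have hinv : (n : ℝ)⁻¹ = Real.exp (-Real.log n) := by rw [Real.exp_neg, Real.exp_log hn0]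
    rw [hinv, ← Real.exp_nat_mul, ← Real.exp_nat_mul, ← Real.exp_nat_mul, ← Real.exp_add,
      ← Real.exp_add]
    refine Real.exp_le_exp.2 ?_
    have e1 : X / 4 * A.card ≤ p / 2 * (A.card * (A'ᶜ.card : ℝ)) := by
      have : (p : ℝ) / 2 * (A.card * (n / 2)) ≤ p / 2 * (A.card * (A'ᶜ.card : ℝ)) := by
        have := p.2.1
        gcongr
      calc X / 4 * A.card = (p : ℝ) / 2 * (A.card * (n / 2)) := by rw [hX]; ring
        _ ≤ _ := this
    have e2 : Real.log n * A'.card ≤ X / 64 * A.card := by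
      calc Real.log n * A'.card ≤ Real.log n * (X / (64 * Real.log n) * A.card) := by gcongr
        _ = _ := by field_simp
    have e3 : Real.log n * A.card ≤ X / 64 * A.card := by
      gcongr; linarith
    have e4 : Real.log n * 1 ≤ Real.log n * A.card := by gcongr
    push_cast
    have e5 : 0 ≤ X * A.card := by positivity
    linarith
  calc (dataLaw θ T p u).real {d | ¬ Expands (obsCount d) (X / (64 * Real.log n)) (X / 8)}
      ≤ (dataLaw θ T p u).real (⋃ Q ∈ S, {d | cut (obsCount d) Q.1 Q.2ᶜ ≤ X / 8 * Q.1.card}) :=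
        measureReal_mono hsub (measure_ne_top _ _)
    _ ≤ ∑ Q ∈ S, (dataLaw θ T p u).real {d | cut (obsCount d) Q.1 Q.2ᶜ ≤ X / 8 * Q.1.card} :=
        measureReal_biUnion_finset_le _ _
    _ ≤ ∑ Q ∈ S, ((n : ℝ)⁻¹) ^ 3 * (((n : ℝ)⁻¹) ^ Q.1.card * ((n : ℝ)⁻¹) ^ Q.2.card) :=
        Finset.sum_le_sum hbound
    _ ≤ ∑ Q : Finset (Fin n) × Finset (Fin n),
          ((n : ℝ)⁻¹) ^ 3 * (((n : ℝ)⁻¹) ^ Q.1.card * ((n : ℝ)⁻¹) ^ Q.2.card) :=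
        Finset.sum_le_sum_of_subset_of_nonneg (Finset.subset_univ _) fun _ _ _ => by positivity
    _ = ((n : ℝ)⁻¹) ^ 3 * ((∑ A : Finset (Fin n), ((n : ℝ)⁻¹) ^ A.card) *
          ∑ A : Finset (Fin n), ((n : ℝ)⁻¹) ^ A.card) := by
        rw [← Finset.mul_sum, Fintype.sum_prod_type, Finset.sum_mul_sum]
    _ ≤ ((n : ℝ)⁻¹) ^ 3 * (3 * 3) := by
        have := sum_inv_pow_card_le (n := n) (by omega)
        gcongr
    _ = 9 / (n : ℝ) ^ 3 := by rw [inv_pow]; ring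

/-- All the scores at the true parameter are small with high probability. -/
lemma dataLaw_real_flow_le (hθ : 1 < θ) (p : unitInterval) (u : Fin n → ℝ)
    (hn : 2 ≤ n) (hp : 64 * Real.log n ≤ n * p) :
    (dataLaw θ T p u).real
      {d | ¬ ∀ k, |flow {k} (pairScore θ d u)| ≤ (T + 3) * √(n * p * Real.log n)} ≤
      2 / (n : ℝ) ^ 2 := by
  have := isProbabilityMeasure_dataLaw (T := T) hθ p u
  have hn0 : (0 : ℝ) < n := by positivity
  have hL : 0 < Real.log n := Real.log_pos (by exact_mod_cast hn)
  set X : ℝ := n * p with hX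
  have hX0 : 0 < X := by linarith
  set s := (T + 3) * √(X * Real.log n) with hs
  -- This choice gives `σ² X = σ √(X log n) = log n`, so the exponent is `T log n - (T + 3) log n =
  -- -3 log n`, enough for `2n` events.
  set σ := √(Real.log n / X) with hσ
  have hσ1 : σ ≤ 1 := by
    rw [hσ, Real.sqrt_le_one, div_le_one hX0]
    linarith
  have hexp : (T : ℝ) * σ ^ 2 * X - σ * s = -(3 * Real.log n) := by
    have h1 : σ ^ 2 * X = Real.log n := by
      rw [hσ, Real.sq_sqrt (by positivity)]
      field_simp
    have h2 : σ * √(X * Real.log n) = Real.log n := by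
      rw [hσ, ← Real.sqrt_mul (by positivity),
        show Real.log n / X * (X * Real.log n) = Real.log n ^ 2 by field_simp,
        Real.sqrt_sq hL.le]
    rw [hs]
    linear_combination (T : ℝ) * h1 - (T + 3) * h2
  have htail : ∀ ε : ℝ, |ε| = 1 → ∀ k, (dataLaw θ T p u).real
      {d | s ≤ ε * flow {k} (pairScore θ d u)} ≤ ((n : ℝ)⁻¹) ^ 3 := by
    intro ε hε k
    refine (dataLaw_real_le_flow hθ p u k (Real.sqrt_nonneg _) hσ1 hε s).trans (le_of_eq ?_)
    rw [hexp, Real.exp_neg, ← Nat.cast_ofNat (n := 3), Real.exp_nat_mul, Real.exp_log hn0, inv_pow]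
  have hsub : {d : Data n T | ¬ ∀ k, |flow {k} (pairScore θ d u)| ≤ s} ⊆
      ⋃ k ∈ (Finset.univ : Finset (Fin n)), ({d | s ≤ 1 * flow {k} (pairScore θ d u)} ∪
        {d | s ≤ -1 * flow {k} (pairScore θ d u)}) := by
    intro d hd
    simp only [Set.mem_ofPred_eq] at hd
    push Not at hd
    obtain ⟨k, hk⟩ := hd
    simp only [Set.mem_iUnion]
    refine ⟨k, Finset.mem_univ k, ?_⟩
    rcases lt_abs.1 hk with h | h
    · exact Or.inl (by simpa using h.le)
    · exact Or.inr (by simpa using h.le)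
  calc _ ≤ _ := measureReal_mono hsub (measure_ne_top _ _)
    _ ≤ _ := measureReal_biUnion_finset_le _ _
    _ ≤ ∑ k : Fin n, (((n : ℝ)⁻¹) ^ 3 + ((n : ℝ)⁻¹) ^ 3) :=
        Finset.sum_le_sum fun k _ => (measureReal_union_le _ _).trans
          (add_le_add (htail 1 (by simp) k) (htail (-1) (by simp) k))
    _ = 2 / (n : ℝ) ^ 2 := by
        rw [Finset.sum_const, Finset.card_univ, Fintype.card_fin, nsmul_eq_mul]
        field_simp
        ring

/-! ### Consistency -/

/-- The event that the maximum likelihood estimate exists, is unique, and is within `ε` of `u`. -/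
def consistentEvent (θ : ℝ) (T : ℕ) {n : ℕ} (u : Fin n → ℝ) (ε : ℝ) : Set (Data n T) :=
  {d | ∃ v : Fin n → ℝ, IsMLE θ d v ∧ (∀ w, IsMLE θ d w → w = v) ∧ ‖v - u‖ ≤ ε}

lemma dynamicRange_nonneg (u : Fin n → ℝ) : 0 ≤ dynamicRange u :=
  Real.iSup_nonneg fun _ => abs_nonneg _

/-! ### Choice of the constants and of the number of steps -/

/-- The constant in front of the rate. -/
def rateConst (θ : ℝ) (T : ℕ) : ℝ := 24 * (T + 3) * (1 + θ) ^ 2 / θ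

lemma rateConst_pos (hθ : 1 < θ) : 0 < rateConst θ T := by unfold rateConst; positivity

lemma sixtyFour_pow_le {L X : ℝ} (hL : 4096 ≤ L) (hX : L ^ 2 ≤ X) : (64 : ℝ) ^ 4 ≤ X := by
  nlinarith

/-- Growing by a factor `X / (64 L)` in each step, `5 L / log X` steps suffice to reach `exp L`. -/
lemma exists_steps {L X : ℝ} (hL : 4096 ≤ L) (hX : L ^ 2 ≤ X) (hXL : Real.log X ≤ L) :
    ∃ K : ℕ, Real.exp L ≤ (X / (64 * L)) ^ K ∧ (K : ℝ) ≤ 5 * (L / Real.log X) ∧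
      1 ≤ X / (64 * L) := by
  have hL0 : 0 < L := by linarith
  have hX4 := sixtyFour_pow_le hL hX
  have hX0 : 0 < X := by linarith
  have hlogX : 4 * Real.log 64 ≤ Real.log X := by
    have := Real.log_le_log (by norm_num) hX4
    rwa [Real.log_pow, Nat.cast_ofNat] at this
  have h64 : 0 < Real.log 64 := Real.log_pos (by norm_num)
  have hlogL : 2 * Real.log L ≤ Real.log X := by
    have := Real.log_le_log (by positivity) hX
    rwa [Real.log_pow, Nat.cast_ofNat] at this
  -- The terms `log 64` and `log L` cost at most a quarter and a half of `log X`. The threshold 4096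
  -- serves here: `4096² = 64⁴`.
  have hr : 1 / 4 * Real.log X ≤ Real.log (X / (64 * L)) := by
    rw [Real.log_div hX0.ne' (by positivity), Real.log_mul (by norm_num) hL0.ne']
    linarith
  have hr0 : 0 < Real.log (X / (64 * L)) := by linarith
  have hrp : 0 < X / (64 * L) := by positivity
  refine ⟨⌈L / Real.log (X / (64 * L))⌉₊, ?_, ?_, ?_⟩
  · rw [← Real.exp_log hrp, ← Real.exp_nat_mul, Real.exp_log hrp]
    refine Real.exp_le_exp.2 ?_
    have := Nat.le_ceil (L / Real.log (X / (64 * L)))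
    rwa [div_le_iff₀ hr0] at this
  · have h1 := (Nat.ceil_lt_add_one (a := L / Real.log (X / (64 * L))) (by positivity)).le
    have h2 : L / Real.log (X / (64 * L)) ≤ L / (1 / 4 * Real.log X) := by
      gcongr
      linarith
    have h3 : L / (1 / 4 * Real.log X) = 4 * (L / Real.log X) := by
      field_simp
    -- The rounding error 1 is absorbed, turning the factor 4 into 5.
    have h4 : 1 ≤ L / Real.log X := by
      rw [le_div_iff₀ (by linarith)]
      linarith
    linarith
  · exact ((Real.log_pos_iff hrp.le).1 hr0).le

lemma dataLaw_real_compl_consistentEvent_le (hθ : 1 < θ) (hT : 1 ≤ T) {p : unitInterval}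
    {u : Fin n → ℝ} (hu : u ∈ normalized n) (hn : 2 ≤ n) (hL : 4096 ≤ Real.log n)
    (hX : Real.log n ^ 2 ≤ n * p) (hrate : rateConst θ T * rate p u ≤ 1) :
    (dataLaw θ T p u).real (consistentEvent θ T u (10 * rateConst θ T * rate p u))ᶜ ≤
      14 / (n : ℝ) ^ 2 := by
  have := isProbabilityMeasure_dataLaw (T := T) hθ p u
  have hn0 : (0 : ℝ) < n := by positivity
  have hn1 : (1 : ℝ) ≤ n := by exact_mod_cast (by omega : 1 ≤ n)
  have hXn : (n : ℝ) * p ≤ n := mul_le_of_le_one_right hn0.le p.2.2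
  set L := Real.log n with hLdef
  set X : ℝ := n * p with hXdef
  set M := dynamicRange u with hM
  have hL0 : 0 < L := by linarith
  have hX4 := sixtyFour_pow_le hL hX
  have hX0 : 0 < X := by linarith
  have h64 : 64 * L ≤ X := by nlinarith
  have hlogX : 0 < Real.log X := Real.log_pos (by linarith)
  have hXL : Real.log X ≤ L := Real.log_le_log hX0 hXn
  obtain ⟨K, hK1, hK2, hr⟩ := exists_steps hL hX hXL
  rw [hLdef, Real.exp_log hn0, ← hLdef] at hK1
  set h := rateConst θ T * (Real.exp M * √(L / X)) with hh
  have hC := rateConst_pos (T := T) hθ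
  have hM0 : 0 ≤ M := dynamicRange_nonneg u
  have hh0 : 0 < h := by positivity
  have hhr : h * (L / Real.log X) ≤ rateConst θ T * rate p u := by
    have : rate p u = Real.exp (2 * M) * √(L / X) * (L / Real.log X) := rfl
    rw [this, hh, ← mul_assoc (rateConst θ T) _ (L / Real.log X)]
    gcongr
    -- The step `h` involves only `e^M`, which is at most the `e^{2M}` of the rate.
    linarith
  have hLX : 1 ≤ L / Real.log X := (one_le_div hlogX).2 hXL
  have hh1 : h ≤ 1 := (le_mul_of_one_le_right hh0.le hLX).trans (hhr.trans hrate)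
  -- Equality holds: the 24 in `rateConst` is the 3 of `slope` times the 8 of the expansion
  -- constant.
  have hs : (T + 3) * √(X * L) ≤ slope θ M * h * (X / 8) := by
    have h1 : √(X * L) = √(L / X) * X := by
      rw [show X * L = L / X * X ^ 2 by field_simp, Real.sqrt_mul (by positivity),
        Real.sqrt_sq hX0.le]
    have h2 : Real.exp (-M) * Real.exp M = 1 := by rw [← Real.exp_add]; simp
    refine le_of_eq ?_
    rw [h1, hh, slope, rateConst]
    have hθ0 : θ ≠ 0 := by positivity
    have hθ1 : 1 + θ ≠ 0 := by positivity
    field_simp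
    linear_combination (-24 : ℝ) * h2
  have hsub : (consistentEvent θ T u (10 * rateConst θ T * rate p u))ᶜ ⊆
      {d | ¬ Expands (obsCount d) (X / (64 * L)) (X / 8)} ∪
      {d | ¬ ∀ k, |flow {k} (pairScore θ d u)| ≤ (T + 3) * √(X * L)} := by
    intro d hd
    by_contra hcon
    simp only [Set.mem_union, Set.mem_ofPred_eq, not_or, not_not] at hcon
    refine hd ?_
    obtain ⟨v, hv1, hv2, hv3⟩ := exists_unique_isMLE_of_expands hθ (by omega) hu hh0 hh1 hr
      (by positivity) hs hK1 hcon.1 hcon.2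
    refine ⟨v, hv1, hv2, hv3.trans ?_⟩
    calc 2 * (K : ℝ) * h ≤ 2 * (5 * (L / Real.log X)) * h := by gcongr
      _ = 10 * (h * (L / Real.log X)) := by ring
      _ ≤ 10 * (rateConst θ T * rate p u) := by gcongr
      _ = _ := by ring
  calc _ ≤ _ := measureReal_mono hsub (measure_ne_top _ _)
    _ ≤ _ := measureReal_union_le _ _
    _ ≤ 9 / (n : ℝ) ^ 3 + 2 / (n : ℝ) ^ 2 :=
        add_le_add (dataLaw_real_not_expands_le hθ hT p u hn h64)
          (dataLaw_real_flow_le hθ p u hn h64)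
    _ ≤ 9 / (n : ℝ) ^ 2 + 2 / (n : ℝ) ^ 2 := by
        gcongr
        norm_num
    _ ≤ _ := by
        rw [← add_div]
        gcongr
        norm_num

/-- If the rate tends to zero, the expected degrees are eventually at least `(log n)²`. -/
lemma eventually_sq_log_le {p : ℕ → unitInterval} {u : (n : ℕ) → Fin n → ℝ}
    (hp : ∃ c : ℝ, 1 < c ∧ ∀ᶠ n : ℕ in atTop, c * (Real.log n / n) ≤ (p n : ℝ))
    (hΔ : Tendsto (fun n : ℕ => rate (p n) (u n)) atTop (𝓝 0)) :
    ∀ᶠ n : ℕ in atTop, Real.log n ^ 2 ≤ n * (p n : ℝ) := by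
  obtain ⟨c, hc, hp⟩ := hp
  have hlog : Tendsto (fun n : ℕ => Real.log n) atTop atTop :=
    Real.tendsto_log_atTop.comp tendsto_natCast_atTop_atTop
  have hll : ∀ᶠ x : ℝ in atTop, 4 * Real.log x ^ 2 ≤ x := by
    have h := (Real.isLittleO_pow_log_id_atTop (n := 2)).bound (by norm_num : (0 : ℝ) < 1 / 4)
    filter_upwards [h, eventually_ge_atTop 0] with x hx hx0
    rw [Real.norm_of_nonneg (sq_nonneg _), id, Real.norm_of_nonneg hx0] at hx
    linarith
  filter_upwards [hp, hlog.eventually hll, hlog.eventually_ge_atTop 2,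
    hΔ.eventually (ge_mem_nhds one_pos), eventually_ge_atTop 2] with n h1 h2 h3 h4 h5
  have hn0 : (0 : ℝ) < n := by positivity
  set L := Real.log n with hL
  set X : ℝ := n * (p n : ℝ) with hX
  -- The degree assumption keeps `X` above 1, so that `log X > 0` and the rate bound can be squared
  -- and rearranged.
  have hLX : L ≤ X := by
    have : (n : ℝ) * (c * (L / n)) ≤ X := by rw [hX]; gcongr
    have e : (n : ℝ) * (c * (L / n)) = c * L := by field_simp
    nlinarith
  have hX0 : 0 < X := by linarith
  have hlogX : 0 < Real.log X := Real.log_pos (by linarith)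
  have hG : √(L / X) * (L / Real.log X) ≤ 1 := by
    refine le_trans ?_ h4
    have : rate (p n) (u n) =
        Real.exp (2 * dynamicRange (u n)) * (√(L / X) * (L / Real.log X)) := by
      rw [← mul_assoc]; rfl
    rw [this]
    refine le_mul_of_one_le_left (by positivity) (Real.one_le_exp ?_)
    linarith [dynamicRange_nonneg (u n)]
  have hG2 : L ^ 3 ≤ X * Real.log X ^ 2 := by
    have h : (√(L / X) * (L / Real.log X)) ^ 2 ≤ 1 := pow_le_one₀ (by positivity) hG
    rw [mul_pow, Real.sq_sqrt (by positivity), div_pow, div_mul_div_comm,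
      div_le_one (by positivity)] at h
    calc L ^ 3 = L * L ^ 2 := by ring
      _ ≤ _ := h
  -- If `X < L²`, then `log X ≤ 2 log L`, so `X log² X < 4 L² log² L ≤ L³`, against `hG2`.
  by_contra! hlt
  have hlogL : Real.log X ≤ 2 * Real.log L := by
    have := Real.log_le_log hX0 hlt.le
    rwa [Real.log_pow, Nat.cast_ofNat] at this
  have : X * Real.log X ^ 2 < L ^ 2 * L := by
    calc X * Real.log X ^ 2 < L ^ 2 * Real.log X ^ 2 := by gcongr
      _ ≤ L ^ 2 * (2 * Real.log L) ^ 2 := by gcongr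
      _ = L ^ 2 * (4 * Real.log L ^ 2) := by ring
      _ ≤ L ^ 2 * L := by gcongr
  nlinarith

lemma eventually_compl_consistentEvent_le (hθ : 1 < θ) (hT : 1 ≤ T)
    {p : ℕ → unitInterval} {u : (n : ℕ) → Fin n → ℝ} (hu : ∀ n, u n ∈ normalized n)
    (hp : ∃ c : ℝ, 1 < c ∧ ∀ᶠ n : ℕ in atTop, c * (Real.log n / n) ≤ (p n : ℝ))
    (hΔ : Tendsto (fun n : ℕ => rate (p n) (u n)) atTop (𝓝 0)) :
    ∀ᶠ n : ℕ in atTop, (dataLaw θ T (p n) (u n)).real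
      (consistentEvent θ T (u n) (10 * rateConst θ T * rate (p n) (u n)))ᶜ ≤ 14 / (n : ℝ) ^ 2 := by
  have hlog : Tendsto (fun n : ℕ => Real.log n) atTop atTop :=
    Real.tendsto_log_atTop.comp tendsto_natCast_atTop_atTop
  have hC := hΔ.const_mul (rateConst θ T)
  rw [mul_zero] at hC
  filter_upwards [eventually_sq_log_le hp hΔ, hlog.eventually_ge_atTop 4096,
    hC.eventually (ge_mem_nhds one_pos), eventually_ge_atTop 2] with n h1 h2 h3 h4
  exact dataLaw_real_compl_consistentEvent_le hθ hT (hu n) h4 h2 h1 h3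

/-- Borel–Cantelli: the failure probabilities are summable, and no independence between different
`n` is required. -/
lemma ae_eventually_consistent (hθ : 1 < θ) {p : ℕ → unitInterval} {u : (n : ℕ) → Fin n → ℝ}
    {ε : ℕ → ℝ} (h : ∀ᶠ n : ℕ in atTop, (dataLaw θ T (p n) (u n)).real
      (consistentEvent θ T (u n) (ε n))ᶜ ≤ 14 / (n : ℝ) ^ 2)
    {Ω : Type*} [MeasurableSpace Ω] {μ : Measure Ω} {D : (n : ℕ) → Ω → Data n T}
    (hD : ∀ n, HasLaw (D n) (dataLaw θ T (p n) (u n)) μ) :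
    ∀ᵐ ω ∂μ, ∀ᶠ n : ℕ in atTop, D n ω ∈ consistentEvent θ T (u n) (ε n) := by
  obtain ⟨N, hN⟩ := eventually_atTop.1 h
  set s : ℕ → Set Ω := fun n =>
    if N ≤ n then D n ⁻¹' (consistentEvent θ T (u n) (ε n))ᶜ else ∅ with hs
  have hle : ∀ n, μ (s n) ≤ ENNReal.ofReal (14 / (n : ℝ) ^ 2) := by
    intro n
    have := isProbabilityMeasure_dataLaw (T := T) hθ (p n) (u n)
    by_cases hn : N ≤ n
    · simp only [hs, hn, if_true]
      -- Only the upper bound on the preimage is used, and it needs no measurability of the event.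
      refine (Measure.le_map_apply (hD n).aemeasurable _).trans ?_
      rw [(hD n).map_eq, ← ENNReal.ofReal_toReal (measure_ne_top _ _)]
      exact ENNReal.ofReal_le_ofReal (hN n hn)
    · simp [hs, hn]
  have hsum : Summable fun n : ℕ => 14 / (n : ℝ) ^ 2 := by
    simpa [div_eq_mul_inv] using
      ((Real.summable_nat_pow_inv (p := 2)).2 (by norm_num)).mul_left 14
  have hfin : ∑' n, μ (s n) ≠ ⊤ :=
    ne_top_of_le_ne_top hsum.tsum_ofReal_ne_top (ENNReal.tsum_le_tsum hle)
  filter_upwards [ae_eventually_notMem hfin] with ω hω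
  filter_upwards [hω, eventually_ge_atTop N] with n hn hNn
  simpa [hs, hNn] using hn

end

end RaoKupper

theorem mainTheorem8 (θ : ℝ) (hθ : 1 < θ) (T : ℕ) (hT : 1 ≤ T)
    (p : ℕ → unitInterval) (u : (n : ℕ) → Fin n → ℝ)
    (hu : ∀ n, u n ∈ RaoKupper.normalized n)
    (hp : ∃ c : ℝ, 1 < c ∧ ∀ᶠ n : ℕ in atTop, c * (Real.log n / n) ≤ (p n : ℝ))
    (hΔ : Tendsto (fun n : ℕ => RaoKupper.rate (p n) (u n)) atTop (𝓝 0)) :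
    -- with probability at least `1 - 14 / n ^ 2` the MLE uniquely exists and has error `O(Δ_n)`
    (∃ C : ℝ, ∀ᶠ n : ℕ in atTop,
      1 - 14 / (n : ℝ) ^ 2 ≤ (RaoKupper.dataLaw θ T (p n) (u n)).real
        {d | ∃ v : Fin n → ℝ, RaoKupper.IsMLE θ d v ∧ (∀ w, RaoKupper.IsMLE θ d w → w = v) ∧
          ‖v - u n‖ ≤ C * RaoKupper.rate (p n) (u n)}) ∧
    -- however the data for different `n` are coupled, almost surely the MLE uniquely exists for all
    -- but finitely many `n` and converges uniformly to the true scores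
    (∀ {Ω : Type*} [MeasurableSpace Ω] (μ : Measure Ω) [IsProbabilityMeasure μ]
      (D : (n : ℕ) → Ω → RaoKupper.Data n T),
      (∀ n, HasLaw (D n) (RaoKupper.dataLaw θ T (p n) (u n)) μ) →
      ∀ᵐ ω ∂μ,
        (∀ᶠ n : ℕ in atTop, ∃! v : Fin n → ℝ, RaoKupper.IsMLE θ (D n ω) v) ∧
        ∀ uhat : (n : ℕ) → Fin n → ℝ,
          (∀ᶠ n : ℕ in atTop, RaoKupper.IsMLE θ (D n ω) (uhat n)) →
          Tendsto (fun n : ℕ => ‖uhat n - u n‖) atTop (𝓝 0)) := by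
  have hbad := RaoKupper.eventually_compl_consistentEvent_le hθ hT hu hp hΔ
  refine ⟨⟨10 * RaoKupper.rateConst θ T, ?_⟩, ?_⟩
  · filter_upwards [hbad] with n hn
    have := RaoKupper.isProbabilityMeasure_dataLaw (T := T) hθ (p n) (u n)
    rw [probReal_compl_eq_one_sub .of_discrete] at hn
    exact sub_le_comm.1 hn
  · intro Ω _ μ _ D hD
    filter_upwards [RaoKupper.ae_eventually_consistent hθ hbad hD] with ω hω
    refine ⟨?_, fun uhat huhat => ?_⟩
    · filter_upwards [hω] with n hn
      obtain ⟨v, h1, h2, -⟩ := hn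
      exact ⟨v, h1, h2⟩
    · have hlim := hΔ.const_mul (10 * RaoKupper.rateConst θ T)
      rw [mul_zero] at hlim
      refine squeeze_zero' (Eventually.of_forall fun n => norm_nonneg _) ?_ hlim
      filter_upwards [hω, huhat] with n hn hmle
      obtain ⟨v, -, h2, h3⟩ := hn
      rwa [h2 _ hmle]
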